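/- **Theorem 2.** Let $G:[0,\infty)\to(0,\infty)$ be *moderate*: non-decreasing, tending to infinity, and such that $G(2t)/G(t)$ is bounded. Let $(P_i)_i$ be at least two, finitely many, distinct laws of a process $(Y_n)_{n\ge1}$ with values in a measurable space, such that $(Y_n)_{n\ge 1}$ is i.i.d. under each $P_i$. Let $\mathcal F_n=\sigma(Y_1,\dots,Y_n)$, let $Q$ be a probability measure with $P_i\ll Q$ for every $i$, and let $P$ be a probability measure which is equivalent to each $P_i$ on every $\mathcal F_n$. Let $p_{in}$ and $p_n$ be the densities of $P_i$ and $P$ with respect to $Q$ on $\mathcal F_n$, and let $R^i_n=p_n/p_{in}$. A decision rule is a pair $(\tau,d)$, where $\tau$ is a $P$-integrable $(\mathcal F_n)_{n\ge0}$-stopping time and $d$ is an $\mathcal F_\tau$-measurable index. For $a=(a_i)_i$ with all $a_i>0$, let $T(a)$ be the set of the $\tau$ for which there is a decision rule $(\tau,d)$ with $P_i[\tau<\infty,\ d\ne i]\le a_i$ for every $i$. For a level $c=(c_i)_i$, let $$\varrho_i=\inf\{n\ge1: R^i_n\ge c_i\},\qquad \tau_c=\min_i\max_{j\ne i}\varrho_j,\qquad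 d_c=\operatorname{argmax}_j\varrho_j,$$ where ties in the argmax are resolved by an arbitrary fixed rule depending only on the set of maximizers. Assume that $$\left|\log R^i_1\right|\,G\!\left(\left|\log R^i_1\right|\right)\ \text{ is } P\text{-integrable for every } i .$$ (1) Suppose that $(Y_n)_{n\ge1}$ is i.i.d. under $P$ (for instance $P=P_k$ for some $k$). Then one can choose a level $c=c(a)$ for each $a$ such that $(\tau_c,d_c)$ is always a decision rule with $P_i[\tau_c<\infty,\ d_c\ne i]\le a_i$ for every $i$ (so $\tau_c\in T(a)$) and, as $a\to0$ (all $a_i\to 0$, at arbitrary relative rates), $$E_P[G(\tau_c)]=\inf\{E_P[G(\tau)]:\tau\in T(a)\}\cdot(1+o(1)).$$ (2) Suppose that $P=\sum_i w_iP_i$ with all $w_i>0$. Then one can choose a level $c=c(a)$ for each $a$ such that $(\tau_c,d_c)$ is always a decision rule with $P_i[\tau_c<\infty,\ d_c\ne i]\le a_i$ for every $i$ and, for every $i$ simultaneously, as $a\to0$, $$E_{P_i}[G(\tau_c)]=\inf\{E_{P_i}[G(\tau)]:\tau\in T(a)\}\cdot(1+o(1)).$$ -/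

import Mathlib

open MeasureTheory ProbabilityTheory Filter Topology
open scoped ENNReal

namespace SequentialTest

noncomputable section

/-- A moderate function: positive and non-decreasing on `[0, ∞)`, tending to infinity, with
`G (2 t) / G t` bounded over `t ≥ 0`.  (The values of `G` at negative reals play no role.) -/
structure IsModerate (G : ℝ → ℝ) : Prop where
  pos : ∀ t, 0 ≤ t → 0 < G t
  mono : MonotoneOn G (Set.Ici 0)
  tendsto_atTop : Tendsto G atTop atTop
  doubling : ∃ C : ℝ, ∀ t, 0 ≤ t → G (2 * t) / G t ≤ C

variable {S ι : Type*} [MeasurableSpace S]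

/-- The σ-field `ℱ n` generated by the first `n` observations.  The sample space is the space
`ℕ → S` of sequences; the observation `Y_{k+1}` is the coordinate `ω ↦ ω k`. -/
def obsFiltration (S : Type*) [MeasurableSpace S] :
    Filtration ℕ (MeasurableSpace.pi : MeasurableSpace (ℕ → S)) where
  seq n := MeasurableSpace.comap (fun (ω : ℕ → S) (k : Fin n) => ω k) MeasurableSpace.pi
  mono' := by
    intro m n hmn
    have h : (fun (ω : ℕ → S) (k : Fin m) => ω k) =
        (fun (v : Fin n → S) (k : Fin m) => v (Fin.castLE hmn k)) ∘
          (fun (ω : ℕ → S) (k : Fin n) => ω k) := rfl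
    simp only
    rw [h, ← MeasurableSpace.comap_comp]
    exact MeasurableSpace.comap_mono
      (measurable_pi_lambda _ fun k => measurable_pi_apply _).comap_le
  le' n := (measurable_pi_lambda _ fun k => measurable_pi_apply _).comap_le

/-- Under `P` the observations are independent and identically distributed. -/
def IsIIDLaw (P : Measure (ℕ → S)) : Prop :=
  iIndepFun (fun (n : ℕ) (ω : ℕ → S) => ω n) P ∧
    ∀ n : ℕ, IdentDistrib (fun ω : ℕ → S => ω n) (fun ω : ℕ → S => ω 0) P P

/-- `P` restricted to `ℱ n`. -/
def restr (P : Measure (ℕ → S)) (n : ℕ) : @Measure (ℕ → S) (obsFiltration S n) :=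
  P.trim ((obsFiltration S).le n)

/-- Local equivalence: equivalence on every `ℱ n`. -/
def LocallyEquivalent (P P' : Measure (ℕ → S)) : Prop :=
  ∀ n : ℕ, restr P n ≪ restr P' n ∧ restr P' n ≪ restr P n

/-- The density of `P` with respect to `Q` on `ℱ n`. -/
def density (Q P : Measure (ℕ → S)) (n : ℕ) (ω : ℕ → S) : ℝ :=
  ((restr P n).rnDeriv (restr Q n) ω).toReal

/-- The likelihood ratio `p_n / p_{i n}` of `P` to `Pi` after `n` observations (densities with
respect to `Q`). -/
def likelihoodRatio (Q P Pi : Measure (ℕ → S)) (n : ℕ) (ω : ℕ → S) : ℝ :=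
  density Q P n ω / density Q Pi n ω

/-- The rejecting time `inf {n ≥ 1 ; R_n ≥ c}` of the hypothesis `Pi` at level `c`
(`∞` when there is no such `n`). -/
def rejectTime (Q P Pi : Measure (ℕ → S)) (c : ℝ) (ω : ℕ → S) : ℕ∞ :=
  sInf {m : ℕ∞ | ∃ n : ℕ, 1 ≤ n ∧ c ≤ likelihoodRatio Q P Pi n ω ∧ m = n}

/-- The observation time `min_i max_{j ≠ i} ϱ_j` of Wald's test at level `c`. -/
def waldTime (Q P : Measure (ℕ → S)) (H : ι → Measure (ℕ → S)) (c : ι → ℝ) (ω : ℕ → S) : ℕ∞ :=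
  ⨅ i, ⨆ j, ⨆ (_ : j ≠ i), rejectTime Q P (H j) (c j) ω

open Classical in
/-- The decision `argmax_j ϱ_j` of Wald's test at level `c`; ties are resolved by the rule `sel`,
which picks an element of the set of all maximizers. -/
def waldDecision [Fintype ι] (sel : Finset ι → ι) (Q P : Measure (ℕ → S))
    (H : ι → Measure (ℕ → S)) (c : ι → ℝ) (ω : ℕ → S) : ι :=
  sel (Finset.univ.filter fun k =>
    ∀ j, rejectTime Q P (H j) (c j) ω ≤ rejectTime Q P (H k) (c k) ω)

/-- A decision rule `(τ, d)`: `τ` is a stopping time which is integrable under `P`, and `d` is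
`ℱ_τ`-measurable. -/
def IsDecisionRule (P : Measure (ℕ → S)) (τ : (ℕ → S) → ℕ∞) (d : (ℕ → S) → ι) : Prop :=
  ∃ hτ : IsStoppingTime (obsFiltration S) τ,
    ∫⁻ ω, (τ ω : ℝ≥0∞) ∂P < ⊤ ∧
    ∀ i, MeasurableSet[hτ.measurableSpace] {ω | d ω = i}

/-- The error probabilities of `(τ, d)` are at most `a`.  A decision is taken only when the
observation stops: the error under `H i` is to stop and to decide for another hypothesis. -/
def ErrorsAtMost (H : ι → Measure (ℕ → S)) (a : ι → ℝ) (τ : (ℕ → S) → ℕ∞)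
    (d : (ℕ → S) → ι) : Prop :=
  ∀ i, H i {ω | τ ω < ⊤ ∧ d ω ≠ i} ≤ ENNReal.ofReal (a i)

/-- The class `T(a)` of observation times of decision rules with error probabilities at most
`a`. -/
def timeClass (P : Measure (ℕ → S)) (H : ι → Measure (ℕ → S)) (a : ι → ℝ) :
    Set ((ℕ → S) → ℕ∞) :=
  {τ | ∃ d : (ℕ → S) → ι, IsDecisionRule P τ d ∧ ErrorsAtMost H a τ d}

/-- `G` at an extended natural number, with `G ∞ = ∞`. -/
def extend (G : ℝ → ℝ) : ℕ∞ → ℝ≥0∞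
  | ⊤ => ⊤
  | (n : ℕ) => ENNReal.ofReal (G n)

/-- The expectation of `G(τ)` under `ν`. -/
def gMoment (G : ℝ → ℝ) (ν : Measure (ℕ → S)) (τ : (ℕ → S) → ℕ∞) : ℝ≥0∞ :=
  ∫⁻ ω, extend G (τ ω) ∂ν

/-- The level `c = c(a)` makes Wald's test meet every prescribed vector `a` of error
probabilities: `(τ_c, d_c)` is a decision rule with error probabilities at most `a`. -/
def WaldAdmissible [Fintype ι] (sel : Finset ι → ι) (Q P : Measure (ℕ → S))
    (H : ι → Measure (ℕ → S)) (c : (ι → ℝ) → ι → ℝ) : Prop :=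
  ∀ a : ι → ℝ, (∀ i, 0 < a i) →
    IsDecisionRule P (waldTime Q P H (c a)) (waldDecision sel Q P H (c a)) ∧
    ErrorsAtMost H a (waldTime Q P H (c a)) (waldDecision sel Q P H (c a))

/-- `E_ν[G(τ_c)] = inf {E_ν[G(τ)] ; τ ∈ T(a)} · (1 + o(1))` as `a → 0`, where `c = c(a)` and `a`
ranges over the vectors with positive coordinates.  (In `ℝ≥0∞` the ratio can tend to `1` only if
its two terms are finite and nonzero for `a` close to `0`.) -/
def WaldAsymptoticallyOptimal (G : ℝ → ℝ) (Q P : Measure (ℕ → S)) (H : ι → Measure (ℕ → S))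
    (c : (ι → ℝ) → ι → ℝ) (ν : Measure (ℕ → S)) : Prop :=
  Tendsto (fun a : ι → ℝ =>
      gMoment G ν (waldTime Q P H (c a)) / ⨅ τ ∈ timeClass P H a, gMoment G ν τ)
    (𝓝[{a : ι → ℝ | ∀ i, 0 < a i}] 0) (𝓝 1)

end

end SequentialTest

/-! The level is `c = 1 / a`. By Ville's inequality the rejecting time of `H i` is finite with `H
i`-probability at most `a i`, and Wald's test can stop and decide against `H i` only if that time is
finite. This settles the errors.

For optimality, let `ν` be the law under which moments are taken: `P` in (1), some `H k` in (2). In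
both cases `w • ν ≤ P` with some `w > 0`, and under `ν` the log-likelihood ratio of `P` to each `H i
≠ ν` is a nondegenerate random walk plus a term that is bounded below and, by Ville, rarely large.
Given a competitor `σ`, lower Wald's level to `exp (-b) * c`. If `σ` stops before Wald's test at the
lower level, then some hypothesis against which `σ` decides is not yet rejected at that level. A
change of measure bounds the probability of this by a constant times `∑ exp (-b) * c i * a i`, which
is small for large `b` (`measure_lt_waldTime_le`).

It remains to see that a constant factor in the level hardly changes the `G`-moment. The Wald times
`τ' ≤ τ` at the two levels need not be compared pathwise. Summation by parts only requires `ν {τ' ≤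
n < τ}` to be small uniformly in `n` (`IsModerate.gMoment_le_add`). Up to small probability this
event confines a walk at time `n` to an interval of bounded length, and the concentration function
of a nondegenerate walk vanishes (`exists_forall_measureReal_sum_mem_Icc_le`).

The error is then a small multiple of `G N`, plus the part of the moment due to times after `N`. Let
`t` be the logarithm of the largest level that matters (`exists_slowest_pair`). For `N` about `B *
t` the late part is negligible by a Chernoff bound. Since `τ` exceeds `δ * t` with probability at
least 1/2, doubling gives `G N ≤ K * E[G(τ)]`, so the whole error is a small fraction of `E[G(τ)]`.
-/

namespace SequentialTest
-- Concentration functions of sums of i.i.d. variables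
section


/-- Esseen's smoothing bound for the concentration function of a law on the line. -/
theorem measureReal_Icc_le_integral_norm_charFun (κ : Measure ℝ) [IsProbabilityMeasure κ]
    (x L : ℝ) :
    κ.real (Set.Icc x (x + L)) * Real.exp (-L ^ 2 / 2) ≤
      ∫ t, ‖charFun κ t‖ ∂(gaussianReal 0 1) := by
  -- The Gaussian kernel is itself a characteristic function, so Fubini moves the transform onto
  -- `κ`.
  have hgauss : ∀ y : ℝ, ((Real.exp (-(y - x) ^ 2 / 2) : ℝ) : ℂ) =
      ∫ t, Complex.exp (↑(y - x) * ↑t * Complex.I) ∂(gaussianReal 0 1) := by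
    intro y
    have h := charFun_gaussianReal (μ := 0) (v := 1) (y - x)
    rw [charFun_apply_real] at h
    rw [h]
    push_cast
    congr 1
    ring
  have hint : Integrable (fun p : ℝ × ℝ => Complex.exp (↑(p.1 - x) * ↑p.2 * Complex.I))
      (κ.prod (gaussianReal 0 1)) := by
    refine Integrable.of_bound (C := 1) ?_ ?_
    · exact (by fun_prop : Continuous fun p : ℝ × ℝ =>
        Complex.exp (↑(p.1 - x) * ↑p.2 * Complex.I)).aestronglyMeasurable
    · refine ae_of_all _ fun p => ?_
      rw [← Complex.ofReal_mul, Complex.norm_exp_ofReal_mul_I]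
  have hswap : ((∫ y, Real.exp (-(y - x) ^ 2 / 2) ∂κ : ℝ) : ℂ) =
      ∫ t, Complex.exp (-(x * t) * Complex.I) * charFun κ t ∂(gaussianReal 0 1) := by
    rw [← integral_complex_ofReal]
    simp_rw [hgauss]
    rw [integral_integral_swap hint]
    refine integral_congr_ae (ae_of_all _ fun t => ?_)
    simp only
    rw [charFun_apply_real, ← integral_const_mul]
    refine integral_congr_ae (ae_of_all _ fun y => ?_)
    simp only
    rw [← Complex.exp_add]
    congr 1
    push_cast
    ring
  have hle : ∫ y, Real.exp (-(y - x) ^ 2 / 2) ∂κ ≤ ∫ t, ‖charFun κ t‖ ∂(gaussianReal 0 1) := by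
    have h1 : ∫ y, Real.exp (-(y - x) ^ 2 / 2) ∂κ ≤
        ‖((∫ y, Real.exp (-(y - x) ^ 2 / 2) ∂κ : ℝ) : ℂ)‖ := by
      rw [Complex.norm_real]; exact le_abs_self _
    refine h1.trans ?_
    rw [hswap]
    refine (norm_integral_le_integral_norm _).trans (le_of_eq ?_)
    refine integral_congr_ae (ae_of_all _ fun t => ?_)
    simp only [norm_mul]
    rw [← Complex.ofReal_mul, ← Complex.ofReal_neg, Complex.norm_exp_ofReal_mul_I, one_mul]
  refine le_trans ?_ hle
  have hexp_int : Integrable (fun y => Real.exp (-(y - x) ^ 2 / 2)) κ := by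
    refine Integrable.of_bound (C := 1)
      (by fun_prop : Continuous fun y : ℝ => Real.exp (-(y - x) ^ 2 / 2)).aestronglyMeasurable ?_
    refine ae_of_all _ fun y => ?_
    rw [Real.norm_eq_abs, abs_of_pos (Real.exp_pos _), Real.exp_le_one_iff]
    nlinarith [sq_nonneg (y - x)]
  calc κ.real (Set.Icc x (x + L)) * Real.exp (-L ^ 2 / 2)
      = ∫ y, (Set.Icc x (x + L)).indicator (fun _ => Real.exp (-L ^ 2 / 2)) y ∂κ := by
        rw [integral_indicator measurableSet_Icc, setIntegral_const, smul_eq_mul]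
    _ ≤ _ := by
        refine integral_mono ((integrable_const _).indicator measurableSet_Icc) hexp_int ?_
        intro y
        by_cases hy : y ∈ Set.Icc x (x + L)
        · rw [Set.indicator_of_mem hy]
          have := hy.1; have := hy.2
          apply Real.exp_le_exp.2
          nlinarith
        · rw [Set.indicator_of_notMem hy]
          positivity

/-- Symmetrization: `‖charFun μ t‖ ^ 2` is the mean of `cos (t * (X - X'))` for independent copies
`X`, `X'`. If it equals 1, this cosine is almost surely 1. For fixed `X ≠ X'` that happens for
countably many `t` only, so by Fubini, for almost every `t`, modulus 1 would force `X = X'` almost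
surely and hence a degenerate law. -/
theorem ae_norm_charFun_lt_one (μ : Measure ℝ) [IsProbabilityMeasure μ]
    (hμ : ∀ c : ℝ, ¬ ∀ᵐ x ∂μ, x = c) :
    ∀ᵐ t, ‖charFun μ t‖ < 1 := by
  set π := μ.prod μ
  have hsq : ∀ t, ‖charFun μ t‖ ^ 2 = ∫ p, Real.cos (t * (p.1 - p.2)) ∂π := by
    intro t
    have h1 : ((‖charFun μ t‖ ^ 2 : ℝ) : ℂ) =
        ∫ p : ℝ × ℝ, Complex.exp (t * p.1 * Complex.I) * Complex.exp (-t * p.2 * Complex.I) ∂π := by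
      rw [integral_prod_mul (fun x : ℝ => Complex.exp (t * x * Complex.I))
        (fun x : ℝ => Complex.exp (-t * x * Complex.I))]
      have h2 := charFun_apply_real (μ := μ) t
      have h3 := charFun_apply_real (μ := μ) (-t)
      rw [charFun_neg] at h3
      push_cast at h3
      rw [← h2, ← h3, Complex.mul_conj, Complex.normSq_eq_norm_sq]
    have h4 := congrArg Complex.re h1
    rw [Complex.ofReal_re] at h4
    rw [h4]
    have hint : Integrable (fun p : ℝ × ℝ =>
        Complex.exp (t * p.1 * Complex.I) * Complex.exp (-t * p.2 * Complex.I)) π := by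
      refine Integrable.of_bound (C := 1) (Continuous.aestronglyMeasurable (by fun_prop)) ?_
      refine ae_of_all _ fun p => ?_
      rw [norm_mul, ← Complex.ofReal_neg, ← Complex.ofReal_mul, ← Complex.ofReal_mul,
        Complex.norm_exp_ofReal_mul_I, Complex.norm_exp_ofReal_mul_I, one_mul]
    have h5 := integral_re hint
    simp only [RCLike.re_to_complex] at h5
    rw [← h5]
    refine integral_congr_ae (ae_of_all _ fun p => ?_)
    simp only
    rw [← Complex.exp_add, ← Complex.exp_ofReal_mul_I_re]
    congr 2
    push_cast
    ring
  have hdiag : ¬ ∀ᵐ p ∂π, p.1 = p.2 := by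
    intro h
    have h1 := Measure.ae_ae_of_ae_prod h
    obtain ⟨x, hx⟩ := h1.exists
    exact hμ x (by filter_upwards [hx] with y hy using hy.symm)
  have hnull : ∀ᵐ t, ∀ᵐ p ∂π, p.1 ≠ p.2 → Real.cos (t * (p.1 - p.2)) ≠ 1 := by
    have hms : MeasurableSet {q : (ℝ × ℝ) × ℝ | q.1.1 ≠ q.1.2 → Real.cos (q.2 * (q.1.1 - q.1.2)) ≠ 1} := by
      have h1 : MeasurableSet {q : (ℝ × ℝ) × ℝ | q.1.1 = q.1.2} :=
        measurableSet_eq_fun (by fun_prop) (by fun_prop)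
      have h2 : MeasurableSet {q : (ℝ × ℝ) × ℝ | Real.cos (q.2 * (q.1.1 - q.1.2)) = 1} :=
        measurableSet_eq_fun (by fun_prop) (by fun_prop)
      convert h1.union h2.compl using 1
      ext q
      simp only [Set.mem_ofPred_eq, Set.mem_union, Set.mem_compl_iff]
      tauto
    have h : ∀ᵐ p ∂π, ∀ᵐ t, p.1 ≠ p.2 → Real.cos (t * (p.1 - p.2)) ≠ 1 := by
      refine ae_of_all _ fun p => ?_
      by_cases hp : p.1 = p.2
      · exact ae_of_all _ fun t h => absurd hp h
      · have hc : (Set.range fun k : ℤ => (k * (2 * Real.pi)) / (p.1 - p.2)).Countable :=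
          Set.countable_range _
        have h0 := hc.ae_notMem (volume : Measure ℝ)
        filter_upwards [h0] with t ht _ hcos
        obtain ⟨k, hk⟩ := (Real.cos_eq_one_iff _).1 hcos
        refine ht ⟨k, ?_⟩
        simp only
        rw [hk, mul_div_assoc, div_self (sub_ne_zero.2 hp), mul_one]
    have h2 := (Measure.ae_ae_comm (μ := π) (ν := (volume : Measure ℝ))
      (p := fun p t => p.1 ≠ p.2 → Real.cos (t * (p.1 - p.2)) ≠ 1) hms).1 h
    exact h2
  filter_upwards [hnull] with t ht
  refine lt_of_le_of_ne (norm_charFun_le_one t) fun hone => hdiag ?_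
  have hcint : Integrable (fun p : ℝ × ℝ => 1 - Real.cos (t * (p.1 - p.2))) π := by
    refine Integrable.of_bound (C := 2) (Continuous.aestronglyMeasurable (by fun_prop)) ?_
    refine ae_of_all _ fun p => ?_
    rw [Real.norm_eq_abs, abs_le]
    constructor <;> linarith [Real.cos_le_one (t * (p.1 - p.2)), Real.neg_one_le_cos (t * (p.1 - p.2))]
  have hcint' : Integrable (fun p : ℝ × ℝ => Real.cos (t * (p.1 - p.2))) π := by
    refine Integrable.of_bound (C := 1) (Continuous.aestronglyMeasurable (by fun_prop)) ?_
    exact ae_of_all _ fun p => Real.abs_cos_le_one _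
  have hzero : ∫ p, (1 - Real.cos (t * (p.1 - p.2))) ∂π = 0 := by
    rw [integral_sub (integrable_const _) hcint', ← hsq t, hone]
    simp
  rw [integral_eq_zero_iff_of_nonneg (fun p => by simp [Real.cos_le_one]) hcint] at hzero
  filter_upwards [hzero, ht] with p hp hp'
  by_contra hne
  refine hp' hne ?_
  simp only [Pi.zero_apply] at hp
  linarith

/-- The concentration function of a sum of `n` independent copies of a nondegenerate random
variable vanishes as `n → ∞`. -/
theorem exists_forall_measureReal_sum_mem_Icc_le {Ω : Type*} [MeasurableSpace Ω] (ν : Measure Ω)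
    [IsProbabilityMeasure ν] (X : ℕ → Ω → ℝ) (hX : ∀ n, Measurable (X n)) (hindep : iIndepFun X ν)
    (hident : ∀ n, IdentDistrib (X n) (X 0) ν ν) (hnd : ∀ c : ℝ, ¬ ∀ᵐ ω ∂ν, X 0 ω = c)
    (L : ℝ) {ε : ℝ} (hε : 0 < ε) :
    ∃ N : ℕ, ∀ n ≥ N, ∀ x : ℝ,
      ν.real {ω | ∑ m ∈ Finset.range n, X m ω ∈ Set.Icc x (x + L)} ≤ ε := by
  set μ := ν.map (X 0)
  have : IsProbabilityMeasure μ := Measure.isProbabilityMeasure_map (hX 0).aemeasurable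
  have hμ : ∀ c : ℝ, ¬ ∀ᵐ x ∂μ, x = c := by
    intro c h
    exact hnd c (ae_of_ae_map (hX 0).aemeasurable h)
  have hγ : ∀ᵐ t ∂(gaussianReal 0 1), ‖charFun μ t‖ < 1 :=
    (gaussianReal_absolutelyContinuous 0 one_ne_zero).ae_le (ae_norm_charFun_lt_one μ hμ)
  -- This integral is the smoothing bound for the sum of `n` copies. It does not involve `x`, hence
  -- the uniformity in `x`.
  have hlim : Tendsto (fun n : ℕ => ∫ t, ‖charFun μ t‖ ^ n ∂(gaussianReal 0 1)) atTop (𝓝 0) := by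
    suffices h : Tendsto (fun n : ℕ => ∫ t, ‖charFun μ t‖ ^ n ∂(gaussianReal 0 1)) atTop
        (𝓝 (∫ _, (0 : ℝ) ∂(gaussianReal 0 1))) by simpa using h
    refine tendsto_integral_of_dominated_convergence (fun _ => (1 : ℝ)) ?_ ?_ ?_ ?_
    · intro n
      exact ((measurable_charFun (μ := μ)).norm.pow_const n).aestronglyMeasurable
    · exact integrable_const _
    · intro n
      refine ae_of_all _ fun t => ?_
      rw [norm_pow, norm_norm]
      exact pow_le_one₀ (norm_nonneg _) (norm_charFun_le_one (μ := μ) t)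
    · filter_upwards [hγ] with t ht
      exact tendsto_pow_atTop_nhds_zero_of_lt_one (norm_nonneg _) ht
  have hev := hlim.eventually (ge_mem_nhds (show 0 < ε * Real.exp (-L ^ 2 / 2) by positivity))
  obtain ⟨N, hN⟩ := eventually_atTop.1 hev
  refine ⟨N, fun n hn x => ?_⟩
  have hmeas : Measurable fun ω => ∑ m ∈ Finset.range n, X m ω :=
    Finset.measurable_sum _ fun m _ => hX m
  set κ := ν.map (fun ω => ∑ m ∈ Finset.range n, X m ω)
  have : IsProbabilityMeasure κ := Measure.isProbabilityMeasure_map hmeas.aemeasurable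
  have hchar : ∀ t, charFun κ t = charFun μ t ^ n := by
    intro t
    have hind : iIndepFun (fun m : Finset.range n => X m) ν := hindep.precomp Subtype.val_injective
    have h1 := iIndepFun.charFun_map_fun_sum_eq_prod (fun m => (hX _).aemeasurable) hind
    have h2 : κ = ν.map (fun ω => ∑ m : Finset.range n, X m ω) := by
      refine congrArg ν.map (funext fun ω => ?_)
      exact (Finset.sum_coe_sort (Finset.range n) fun m => X m ω).symm
    rw [h2, h1, Finset.prod_apply]
    have h3 : ∀ m : Finset.range n, charFun (ν.map (X m)) t = charFun μ t := fun m => by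
      rw [(hident m).map_eq]
    simp [h3]
  have h := measureReal_Icc_le_integral_norm_charFun κ x L
  simp_rw [hchar, norm_pow] at h
  have h' := h.trans (hN n hn)
  have hpos := Real.exp_pos (-L ^ 2 / 2)
  have := le_of_mul_le_mul_right h' hpos
  rwa [map_measureReal_apply hmeas measurableSet_Icc] at this

end

/-! ### Densities and likelihood ratios on `ℱ n`; product form for i.i.d. laws -/

section


/-- The chain rule for densities. It holds `μ`-a.e. because `μ.rnDeriv q` is positive there, so the
default value of division by zero plays no role. -/
theorem rnDeriv_div_rnDeriv {Ω : Type*} {m : MeasurableSpace Ω} (p μ q : Measure Ω)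
    [IsFiniteMeasure p] [IsFiniteMeasure μ] [IsFiniteMeasure q] (hp : p ≪ μ) (hμ : μ ≪ q) :
    (fun ω => ENNReal.ofReal ((p.rnDeriv q ω).toReal / (μ.rnDeriv q ω).toReal)) =ᵐ[μ]
      p.rnDeriv μ := by
  filter_upwards [hμ.ae_le (Measure.rnDeriv_mul_rnDeriv (κ := q) hp), Measure.rnDeriv_pos hμ,
    hμ.ae_le (Measure.rnDeriv_lt_top μ q), Measure.rnDeriv_lt_top p μ] with ω h1 h2 h3 h4
  rw [← h1, Pi.mul_apply, ENNReal.toReal_mul, mul_div_assoc,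
    div_self (ENNReal.toReal_pos h2.ne' h3.ne).ne', mul_one, ENNReal.ofReal_toReal h4.ne]

variable {S : Type*} [MeasurableSpace S]

theorem restr_apply (P : Measure (ℕ → S)) (n : ℕ) {A : Set (ℕ → S)}
    (hA : MeasurableSet[obsFiltration S n] A) : restr P n A = P A :=
  trim_measurableSet_eq _ hA

instance isProbabilityMeasure_restr (P : Measure (ℕ → S)) [IsProbabilityMeasure P] (n : ℕ) :
    @IsProbabilityMeasure _ (obsFiltration S n) (restr P n) :=
  @IsProbabilityMeasure.mk _ (obsFiltration S n) _
    ((restr_apply P n (@MeasurableSet.univ _ (obsFiltration S n))).trans measure_univ)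

theorem measurable_density (Q P : Measure (ℕ → S)) (n : ℕ) :
    Measurable[obsFiltration S n] (density Q P n) :=
  (Measure.measurable_rnDeriv _ _).ennreal_toReal

theorem measurable_likelihoodRatio (Q P Pi : Measure (ℕ → S)) (n : ℕ) :
    Measurable[obsFiltration S n] (likelihoodRatio Q P Pi n) :=
  Measurable.div (measurable_density Q P n) (measurable_density Q Pi n)

theorem density_nonneg (Q P : Measure (ℕ → S)) (n : ℕ) (ω : ℕ → S) : 0 ≤ density Q P n ω :=
  ENNReal.toReal_nonneg

theorem likelihoodRatio_nonneg (Q P Pi : Measure (ℕ → S)) (n : ℕ) (ω : ℕ → S) :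
    0 ≤ likelihoodRatio Q P Pi n ω :=
  div_nonneg (density_nonneg _ _ _ _) (density_nonneg _ _ _ _)

theorem ae_density_pos (Q P : Measure (ℕ → S)) [IsProbabilityMeasure Q] [IsProbabilityMeasure P]
    (n : ℕ) (hPQ : restr P n ≪ restr Q n) : ∀ᵐ ω ∂P, 0 < density Q P n ω := by
  have h1 : ∀ᵐ ω ∂(restr P n), 0 < (restr P n).rnDeriv (restr Q n) ω := Measure.rnDeriv_pos hPQ
  have h2 : ∀ᵐ ω ∂(restr P n), (restr P n).rnDeriv (restr Q n) ω < ⊤ :=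
    hPQ.ae_le (Measure.rnDeriv_lt_top _ _)
  filter_upwards [ae_of_ae_trim _ h1, ae_of_ae_trim _ h2] with ω h1 h2
  exact ENNReal.toReal_pos h1.ne' h2.ne

theorem setLIntegral_likelihoodRatio (Q P μ : Measure (ℕ → S)) [IsProbabilityMeasure Q]
    [IsProbabilityMeasure P] [IsProbabilityMeasure μ] (n : ℕ) (hPμ : restr P n ≪ restr μ n)
    (hμQ : restr μ n ≪ restr Q n) {A : Set (ℕ → S)} (hA : MeasurableSet[obsFiltration S n] A) :
    ∫⁻ ω in A, ENNReal.ofReal (likelihoodRatio Q P μ n ω) ∂μ = P A := by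
  have h1 : Measurable[obsFiltration S n] fun ω => ENNReal.ofReal (likelihoodRatio Q P μ n ω) :=
    (measurable_likelihoodRatio Q P μ n).ennreal_ofReal
  rw [← setLIntegral_trim ((obsFiltration S).le n) h1 hA, ← restr_apply P n hA,
    ← Measure.setLIntegral_rnDeriv hPμ]
  refine lintegral_congr_ae (ae_restrict_of_ae ?_)
  exact @rnDeriv_div_rnDeriv _ (obsFiltration S n) (restr P n) (restr μ n) (restr Q n) _ _ _ hPμ hμQ

theorem mul_measure_le_of_le_likelihoodRatio (Q P μ : Measure (ℕ → S)) [IsProbabilityMeasure Q]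
    [IsProbabilityMeasure P] [IsProbabilityMeasure μ] (n : ℕ) (hPμ : restr P n ≪ restr μ n)
    (hμQ : restr μ n ≪ restr Q n) {A : Set (ℕ → S)} (hA : MeasurableSet[obsFiltration S n] A)
    (c : ℝ) (hc : ∀ ω ∈ A, c ≤ likelihoodRatio Q P μ n ω) :
    ENNReal.ofReal c * μ A ≤ P A := by
  rw [← setLIntegral_likelihoodRatio Q P μ n hPμ hμQ hA, ← setLIntegral_const]
  exact setLIntegral_mono' ((obsFiltration S).le n _ hA) fun ω hω => ENNReal.ofReal_le_ofReal (hc ω hω)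

theorem measure_le_mul_of_likelihoodRatio_le (Q P μ : Measure (ℕ → S)) [IsProbabilityMeasure Q]
    [IsProbabilityMeasure P] [IsProbabilityMeasure μ] (n : ℕ) (hPμ : restr P n ≪ restr μ n)
    (hμQ : restr μ n ≪ restr Q n) {A : Set (ℕ → S)} (hA : MeasurableSet[obsFiltration S n] A)
    (c : ℝ) (hc : ∀ ω ∈ A, likelihoodRatio Q P μ n ω ≤ c) :
    P A ≤ ENNReal.ofReal c * μ A := by
  rw [← setLIntegral_likelihoodRatio Q P μ n hPμ hμQ hA, ← setLIntegral_const]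
  exact setLIntegral_mono' ((obsFiltration S).le n _ hA) fun ω hω => ENNReal.ofReal_le_ofReal (hc ω hω)

theorem LocallyEquivalent.symm {P P' : Measure (ℕ → S)} (h : LocallyEquivalent P P') :
    LocallyEquivalent P' P := fun n => (h n).symm

theorem LocallyEquivalent.trans {P P' P'' : Measure (ℕ → S)} (h : LocallyEquivalent P P')
    (h' : LocallyEquivalent P' P'') : LocallyEquivalent P P'' :=
  fun n => ⟨(h n).1.trans (h' n).1, (h' n).2.trans (h n).2⟩

theorem LocallyEquivalent.refl (P : Measure (ℕ → S)) : LocallyEquivalent P P :=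
  fun _ => ⟨Measure.AbsolutelyContinuous.rfl, Measure.AbsolutelyContinuous.rfl⟩

theorem restr_absolutelyContinuous {P Q : Measure (ℕ → S)} (h : P ≪ Q) (n : ℕ) :
    restr P n ≪ restr Q n :=
  h.trim _

/-- The law of the first observation. -/
noncomputable def marginal (P : Measure (ℕ → S)) : Measure S := P.map fun ω => ω 0

instance (P : Measure (ℕ → S)) [IsProbabilityMeasure P] : IsProbabilityMeasure (marginal P) :=
  Measure.isProbabilityMeasure_map (measurable_pi_apply 0).aemeasurable

theorem IsIIDLaw.map_eval {P : Measure (ℕ → S)} (hP : IsIIDLaw P) (n : ℕ) :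
    P.map (fun ω => ω n) = marginal P :=
  (hP.2 n).map_eq

theorem IsIIDLaw.eq_of_marginal_eq {P P' : Measure (ℕ → S)} (hP : IsIIDLaw P) (hP' : IsIIDLaw P')
    (h : marginal P = marginal P') : P = P' := by
  have h1 := hP.1.map_fun_eq_infinitePi_map fun n => measurable_pi_apply n
  have h2 := hP'.1.map_fun_eq_infinitePi_map fun n => measurable_pi_apply n
  simp only [hP.map_eval] at h1
  simp only [hP'.map_eval] at h2
  have h3 : (fun (ω : ℕ → S) (i : ℕ) => ω i) = id := rfl
  rw [h3, Measure.map_id] at h1 h2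
  rw [h1, h2, h]

theorem measurable_obs {n m : ℕ} (h : m < n) :
    Measurable[obsFiltration S n] fun ω : ℕ → S => ω m := by
  have h1 : Measurable[obsFiltration S n] fun (ω : ℕ → S) (k : Fin n) => ω k :=
    comap_measurable _
  exact (measurable_pi_apply (⟨m, h⟩ : Fin n)).comp h1

theorem marginal_absolutelyContinuous {P P' : Measure (ℕ → S)} (h : restr P 1 ≪ restr P' 1) :
    marginal P ≪ marginal P' := by
  refine Measure.AbsolutelyContinuous.mk fun s hs h0 => ?_
  rw [marginal, Measure.map_apply (measurable_pi_apply 0) hs] at h0 ⊢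
  have hm : MeasurableSet[obsFiltration S 1] ((fun ω : ℕ → S => ω 0) ⁻¹' s) :=
    measurable_obs one_pos hs
  rw [← restr_apply _ 1 hm] at h0 ⊢
  exact h h0

/-- The density of a law with independent identically distributed observations with respect to
another one, on the first `n` observations. -/
theorem IsIIDLaw.setLIntegral_prod_rnDeriv {ν μ : Measure (ℕ → S)} [IsProbabilityMeasure ν]
    [IsProbabilityMeasure μ] (hν : IsIIDLaw ν) (hμ : IsIIDLaw μ)
    (hac : marginal ν ≪ marginal μ) (n : ℕ) {A : Set (ℕ → S)}
    (hA : MeasurableSet[obsFiltration S n] A) :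
    ∫⁻ ω in A, ∏ m : Fin n, (marginal ν).rnDeriv (marginal μ) (ω m) ∂μ = ν A := by
  set r := (marginal ν).rnDeriv (marginal μ)
  have hr : Measurable r := Measure.measurable_rnDeriv _ _
  obtain ⟨B, hB, rfl⟩ := hA
  have hrest : Measurable fun (ω : ℕ → S) (k : Fin n) => ω k :=
    measurable_pi_lambda _ fun k => measurable_pi_apply _
  have hν' : iIndepFun (fun (m : Fin n) (ω : ℕ → S) => ω m) ν :=
    hν.1.precomp Fin.val_injective
  have hμ' : iIndepFun (fun (m : Fin n) (ω : ℕ → S) => ω m) μ :=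
    hμ.1.precomp Fin.val_injective
  have h1 : ν.map (fun (ω : ℕ → S) (k : Fin n) => ω k) = Measure.pi fun _ => marginal ν := by
    rw [hν'.map_fun_eq_pi_map fun m => (measurable_pi_apply _).aemeasurable]
    simp only [hν.map_eval]
  have h2 : (Measure.pi fun _ => marginal ν) =
      (μ.withDensity fun ω => ∏ m : Fin n, r (ω m)).map
        (fun (ω : ℕ → S) (k : Fin n) => ω k) := by
    -- It suffices to test rectangles, where independence under `μ` factors the integral.
    refine Measure.pi_eq fun s hs => ?_
    have hpre : MeasurableSet ((fun (ω : ℕ → S) (k : Fin n) => ω k) ⁻¹' Set.univ.pi s) :=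
      hrest (.univ_pi hs)
    rw [Measure.map_apply hrest (.univ_pi hs), withDensity_apply _ hpre, ← lintegral_indicator hpre]
    have h3 : ∀ ω : ℕ → S, ((fun (ω : ℕ → S) (k : Fin n) => ω k) ⁻¹' Set.univ.pi s).indicator
        (fun ω => ∏ m : Fin n, r (ω m)) ω = ∏ m : Fin n, (s m).indicator r (ω m) := by
      intro ω
      by_cases h : ∀ m : Fin n, ω m ∈ s m
      · rw [Set.indicator_of_mem (by simpa using h)]
        exact Finset.prod_congr rfl fun m _ => (Set.indicator_of_mem (h m) _).symm
      · rw [Set.indicator_of_notMem (by simpa using h)]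
        push Not at h
        obtain ⟨m, hm⟩ := h
        exact (Finset.prod_eq_zero (Finset.mem_univ m) (Set.indicator_of_notMem hm _)).symm
    simp_rw [h3]
    rw [lintegral_prod_eq_prod_lintegral_of_indepFun Finset.univ
      (fun (m : Fin n) (ω : ℕ → S) => (s m).indicator r (ω m))
      (hμ'.comp (fun m => (s m).indicator r) fun m => hr.indicator (hs m))
      fun m => (hr.indicator (hs m)).comp (measurable_pi_apply _)]
    refine Finset.prod_congr rfl fun m _ => ?_
    rw [← lintegral_map (hr.indicator (hs m)) (measurable_pi_apply (m : ℕ)), hμ.map_eval,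
      lintegral_indicator (hs m), Measure.setLIntegral_rnDeriv hac]
  rw [← withDensity_apply _ (hrest hB), ← Measure.map_apply hrest hB, ← h2, ← h1,
    Measure.map_apply hrest hB]

/-- On `ℱ n` the likelihood ratio and the product of the marginal densities integrate over every
event to its `ν`-probability, so they agree a.e. The logarithms are legitimate since each factor is
positive and finite `ν`-a.e. -/
theorem IsIIDLaw.ae_likelihoodRatio_eq {Q ν μ : Measure (ℕ → S)} [IsProbabilityMeasure Q]
    [IsProbabilityMeasure ν] [IsProbabilityMeasure μ] (hν : IsIIDLaw ν) (hμ : IsIIDLaw μ)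
    (hνμ : LocallyEquivalent ν μ) (hμQ : ∀ n, restr μ n ≪ restr Q n) :
    ∀ᵐ ω ∂ν, ∀ n, likelihoodRatio Q ν μ n ω =
      Real.exp (∑ m ∈ Finset.range n,
        Real.log ((marginal ν).rnDeriv (marginal μ) (ω m)).toReal) := by
  set r := (marginal ν).rnDeriv (marginal μ)
  have hr : Measurable r := Measure.measurable_rnDeriv _ _
  have hac := marginal_absolutelyContinuous (hνμ 1).1
  have hpos : ∀ᵐ ω ∂ν, ∀ m, 0 < (r (ω m)).toReal := by
    rw [ae_all_iff]
    intro m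
    have h1 : ∀ᵐ y ∂(marginal ν), 0 < (r y).toReal := by
      filter_upwards [Measure.rnDeriv_pos hac, hac.ae_le (Measure.rnDeriv_lt_top (marginal ν) (marginal μ))] with y h1 h2
      exact ENNReal.toReal_pos h1.ne' h2.ne
    rw [← hν.map_eval m] at h1
    exact ae_of_ae_map (measurable_pi_apply m).aemeasurable h1
  have hall : ∀ᵐ ω ∂ν, ∀ n, ENNReal.ofReal (likelihoodRatio Q ν μ n ω) =
      ∏ m : Fin n, r (ω m) := by
    rw [ae_all_iff]
    intro n
    have hm1 : Measurable[obsFiltration S n] fun ω =>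
        ENNReal.ofReal (likelihoodRatio Q ν μ n ω) :=
      (measurable_likelihoodRatio Q ν μ n).ennreal_ofReal
    have hm2 : Measurable[obsFiltration S n] fun ω : ℕ → S => ∏ m : Fin n, r (ω m) :=
      Finset.measurable_prod _ fun m _ => hr.comp (measurable_obs m.2)
    have h1 : (fun ω => ENNReal.ofReal (likelihoodRatio Q ν μ n ω)) =ᵐ[restr μ n]
        fun ω => ∏ m : Fin n, r (ω m) := by
      refine ae_eq_of_forall_setLIntegral_eq_of_sigmaFinite hm1 hm2 fun A hA _ => ?_
      rw [restr, setLIntegral_trim _ hm1 hA, setLIntegral_trim _ hm2 hA,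
        setLIntegral_likelihoodRatio Q ν μ n (hνμ n).1 (hμQ n) hA,
        hν.setLIntegral_prod_rnDeriv hμ hac n hA]
    exact ae_of_ae_trim _ ((hνμ n).1.ae_le h1)
  filter_upwards [hpos, hall] with ω h1 h2 n
  have h3 := congrArg ENNReal.toReal (h2 n)
  rw [ENNReal.toReal_ofReal (likelihoodRatio_nonneg _ _ _ _ _), ENNReal.toReal_prod] at h3
  rw [h3, Real.exp_sum, ← Fin.prod_univ_eq_prod_range (fun m => Real.exp (Real.log (r (ω m)).toReal))]
  exact Finset.prod_congr rfl fun m _ => (Real.exp_log (h1 m)).symm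

/-- The logarithm of the likelihood ratio of two distinct locally equivalent laws with independent
identically distributed observations is a nondegenerate random walk. -/
theorem exists_logRatio {Q ν μ : Measure (ℕ → S)} [IsProbabilityMeasure Q]
    [IsProbabilityMeasure ν] [IsProbabilityMeasure μ] (hν : IsIIDLaw ν) (hμ : IsIIDLaw μ)
    (hνμ : LocallyEquivalent ν μ) (hμQ : ∀ n, restr μ n ≪ restr Q n) (hne : ν ≠ μ) :
    ∃ f : S → ℝ, Measurable f ∧
      (∀ᵐ ω ∂ν, ∀ n, likelihoodRatio Q ν μ n ω =
        Real.exp (∑ m ∈ Finset.range n, f (ω m))) ∧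
      Integrable (fun ω => Real.exp (-f (ω 0))) ν ∧ ∫ ω, Real.exp (-f (ω 0)) ∂ν = 1 ∧
      ∀ c : ℝ, ¬ ∀ᵐ ω ∂ν, f (ω 0) = c := by
  set r := (marginal ν).rnDeriv (marginal μ)
  have hr : Measurable r := Measure.measurable_rnDeriv _ _
  have hac := marginal_absolutelyContinuous (hνμ 1).1
  have hac' := marginal_absolutelyContinuous (hνμ 1).2
  have hf : Measurable fun y => Real.log (r y).toReal := hr.ennreal_toReal.log
  have hexp : ∀ᵐ y ∂(marginal ν), Real.exp (-Real.log (r y).toReal) =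
      ((marginal μ).rnDeriv (marginal ν) y).toReal := by
    filter_upwards [Measure.rnDeriv_pos hac, hac.ae_le (Measure.rnDeriv_lt_top (marginal ν) (marginal μ)),
      Measure.inv_rnDeriv hac] with y h1 h2 h3
    rw [← h3, Real.exp_neg, Real.exp_log (ENNReal.toReal_pos h1.ne' h2.ne), Pi.inv_apply,
      ENNReal.toReal_inv]
  have hint : Integrable (fun y => Real.exp (-Real.log (r y).toReal)) (marginal ν) :=
    Measure.integrable_toReal_rnDeriv.congr (by filter_upwards [hexp] with y hy using hy.symm)
  have hone : ∫ y, Real.exp (-Real.log (r y).toReal) ∂(marginal ν) = 1 := by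
    rw [integral_congr_ae hexp, Measure.integral_toReal_rnDeriv hac']
    simp
  have h0 : AEMeasurable (fun ω : ℕ → S => ω 0) ν := (measurable_pi_apply 0).aemeasurable
  have hmeasexp : Measurable fun y => Real.exp (-Real.log (r y).toReal) := hf.neg.exp
  refine ⟨fun y => Real.log (r y).toReal, hf, hν.ae_likelihoodRatio_eq hμ hνμ hμQ, ?_, ?_, ?_⟩
  · exact (integrable_map_measure hmeasexp.aestronglyMeasurable h0).1 hint
  · rw [← hone, marginal, integral_map h0 hmeasexp.aestronglyMeasurable]
  · intro c hc
    have hc' : ∀ᵐ y ∂(marginal ν), Real.log (r y).toReal = c :=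
      (ae_map_iff h0 (measurableSet_eq_fun hf measurable_const)).2 hc
    -- A constant log-ratio must vanish because `exp (-f)` has mean 1. Then the marginals coincide,
    -- and with them the two i.i.d. laws.
    have hc0 : Real.exp (-c) = 1 := by
      rw [← hone, integral_congr_ae (g := fun _ => Real.exp (-c))]
      · simp
      · filter_upwards [hc'] with y hy
        rw [hy]
    refine hne (hν.eq_of_marginal_eq hμ ?_)
    rw [← Measure.withDensity_rnDeriv_eq _ _ hac']
    have h1 : (marginal μ).rnDeriv (marginal ν) =ᵐ[marginal ν] 1 := by
      filter_upwards [hexp, hc', Measure.rnDeriv_lt_top (marginal μ) (marginal ν)] with y h2 h3 h4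
      rw [h3, hc0] at h2
      rw [Pi.one_apply, ← ENNReal.ofReal_toReal h4.ne, ← h2, ENNReal.ofReal_one]
    rw [withDensity_congr_ae h1, withDensity_one]

end

/-! ### Rejecting times, Ville's inequality and Wald's test -/

section


variable {S ι : Type*} [MeasurableSpace S]

section RejectTime

variable {Q P μ : Measure (ℕ → S)} {c : ℝ} {ω : ℕ → S}

theorem rejectTime_le_natCast_iff {n : ℕ} :
    rejectTime Q P μ c ω ≤ n ↔ ∃ m, 1 ≤ m ∧ m ≤ n ∧ c ≤ likelihoodRatio Q P μ m ω := by
  constructor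
  · intro h
    rcases Set.eq_empty_or_nonempty
      {m : ℕ∞ | ∃ n : ℕ, 1 ≤ n ∧ c ≤ likelihoodRatio Q P μ n ω ∧ m = n} with he | hne
    · rw [rejectTime, he, sInf_empty, top_le_iff] at h
      exact absurd h (ENat.natCast_ne_top n)
    · obtain ⟨m, hm, hc, hmeq⟩ := csInf_mem hne
      rw [rejectTime, hmeq] at h
      exact ⟨m, hm, by exact_mod_cast h, hc⟩
  · rintro ⟨m, hm, hmn, hc⟩
    have h : rejectTime Q P μ c ω ≤ m := sInf_le ⟨m, hm, hc, rfl⟩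
    exact h.trans (by exact_mod_cast hmn)

theorem natCast_lt_rejectTime_iff {n : ℕ} :
    (n : ℕ∞) < rejectTime Q P μ c ω ↔
      ∀ m, 1 ≤ m → m ≤ n → likelihoodRatio Q P μ m ω < c := by
  rw [← not_le, rejectTime_le_natCast_iff]
  push Not
  rfl

theorem rejectTime_lt_top_iff :
    rejectTime Q P μ c ω < ⊤ ↔ ∃ m, 1 ≤ m ∧ c ≤ likelihoodRatio Q P μ m ω := by
  constructor
  · intro h
    obtain ⟨n, hn⟩ := ENat.ne_top_iff_exists.1 h.ne
    obtain ⟨m, h1, _, h2⟩ := rejectTime_le_natCast_iff.1 hn.ge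
    exact ⟨m, h1, h2⟩
  · rintro ⟨m, h1, h2⟩
    exact (rejectTime_le_natCast_iff.2 ⟨m, h1, le_rfl, h2⟩).trans_lt (ENat.natCast_lt_top m)

theorem le_likelihoodRatio_of_rejectTime_eq {n : ℕ} (h : rejectTime Q P μ c ω = n) :
    c ≤ likelihoodRatio Q P μ n ω := by
  obtain ⟨m, h1, h2, h3⟩ := rejectTime_le_natCast_iff.1 h.le
  have h4 : rejectTime Q P μ c ω ≤ m := rejectTime_le_natCast_iff.2 ⟨m, h1, le_rfl, h3⟩
  rw [h] at h4
  have h5 : n ≤ m := by exact_mod_cast h4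
  rwa [le_antisymm h5 h2]

theorem rejectTime_mono {c' : ℝ} (h : c ≤ c') :
    rejectTime Q P μ c ω ≤ rejectTime Q P μ c' ω := by
  refine sInf_le_sInf ?_
  rintro m ⟨n, hn, hc, rfl⟩
  exact ⟨n, hn, h.trans hc, rfl⟩

variable (Q P μ c) in
theorem isStoppingTime_rejectTime :
    IsStoppingTime (obsFiltration S) (rejectTime Q P μ c) := by
  intro n
  have h : {ω | rejectTime Q P μ c ω ≤ (n : ℕ∞)} =
      ⋃ m ∈ Finset.Icc 1 n, {ω | c ≤ likelihoodRatio Q P μ m ω} := by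
    ext ω
    simp only [Set.mem_ofPred_eq, rejectTime_le_natCast_iff, Set.mem_iUnion, Finset.mem_Icc,
      exists_prop, and_assoc]
  change MeasurableSet[obsFiltration S n] {ω | rejectTime Q P μ c ω ≤ (n : ℕ∞)}
  rw [h]
  refine Finset.measurableSet_biUnion _ fun m hm => ?_
  refine (obsFiltration S).mono (Finset.mem_Icc.1 hm).2 _ ?_
  exact measurableSet_le measurable_const (measurable_likelihoodRatio Q P μ m)

theorem measurableSet_eq_natCast {τ : (ℕ → S) → ℕ∞} (hτ : IsStoppingTime (obsFiltration S) τ)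
    (n : ℕ) : MeasurableSet[obsFiltration S n] {ω | τ ω = n} :=
  hτ.measurableSet_eq n

theorem setOf_lt_top_eq_iUnion {Ω : Type*} (τ : Ω → ℕ∞) (A : Set Ω) :
    {ω | τ ω < ⊤ ∧ ω ∈ A} = ⋃ n : ℕ, A ∩ {ω | τ ω = n} := by
  ext ω
  simp only [Set.mem_ofPred_eq, Set.mem_iUnion, Set.mem_inter_iff]
  constructor
  · rintro ⟨h, hA⟩
    obtain ⟨n, hn⟩ := ENat.ne_top_iff_exists.1 h.ne
    exact ⟨n, hA, hn.symm⟩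
  · rintro ⟨n, hA, hn⟩
    exact ⟨hn ▸ ENat.natCast_lt_top n, hA⟩

theorem measure_lt_top_and_eq_tsum (ν : Measure (ℕ → S)) {τ : (ℕ → S) → ℕ∞} {A : Set (ℕ → S)}
    (hA : ∀ n : ℕ, MeasurableSet[obsFiltration S n] (A ∩ {ω | τ ω = n})) :
    ν {ω | τ ω < ⊤ ∧ ω ∈ A} = ∑' n : ℕ, ν (A ∩ {ω | τ ω = n}) := by
  rw [setOf_lt_top_eq_iUnion, measure_iUnion _ fun n => (obsFiltration S).le n _ (hA n)]
  intro m n hmn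
  refine Set.disjoint_left.2 ?_
  rintro ω ⟨_, h1⟩ ⟨_, h2⟩
  exact hmn (by exact_mod_cast (h1.symm.trans h2 : (m : ℕ∞) = n))

/-- Ville's inequality for the likelihood ratio. -/
theorem mul_measure_rejectTime_lt_top_le [IsProbabilityMeasure Q] [IsProbabilityMeasure P]
    [IsProbabilityMeasure μ] (hPμ : ∀ n, restr P n ≪ restr μ n)
    (hμQ : ∀ n, restr μ n ≪ restr Q n) (c : ℝ) :
    ENNReal.ofReal c * μ {ω | rejectTime Q P μ c ω < ⊤} ≤ 1 := by
  have hst := isStoppingTime_rejectTime Q P μ c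
  have hmeas : ∀ n : ℕ,
      MeasurableSet[obsFiltration S n] (Set.univ ∩ {ω | rejectTime Q P μ c ω = n}) := fun n => by
    rw [Set.univ_inter]
    exact measurableSet_eq_natCast hst n
  have h1 := measure_lt_top_and_eq_tsum μ hmeas
  have h2 := measure_lt_top_and_eq_tsum P hmeas
  simp only [Set.mem_univ, and_true] at h1 h2
  rw [h1, ← ENNReal.tsum_mul_left]
  refine le_trans (ENNReal.tsum_le_tsum fun n => ?_) (h2.symm.le.trans prob_le_one)
  refine mul_measure_le_of_le_likelihoodRatio Q P μ n (hPμ n) (hμQ n) (hmeas n) c ?_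
  rintro ω ⟨_, hω⟩
  exact le_likelihoodRatio_of_rejectTime_eq hω

theorem measure_rejectTime_lt_top_le [IsProbabilityMeasure Q] [IsProbabilityMeasure P]
    [IsProbabilityMeasure μ] (hPμ : ∀ n, restr P n ≪ restr μ n)
    (hμQ : ∀ n, restr μ n ≪ restr Q n) {c : ℝ} (hc : 0 < c) :
    μ {ω | rejectTime Q P μ c ω < ⊤} ≤ ENNReal.ofReal c⁻¹ := by
  have h := mul_measure_rejectTime_lt_top_le hPμ hμQ c
  rwa [ENNReal.ofReal_inv_of_pos hc, ENNReal.le_inv_iff_mul_le, mul_comm]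

end RejectTime

section WaldTime

variable {Q P : Measure (ℕ → S)} {H : ι → Measure (ℕ → S)} {c : ι → ℝ} {ω : ℕ → S}

theorem waldTime_le_iff [Finite ι] [Nonempty ι] {x : ℕ∞} :
    waldTime Q P H c ω ≤ x ↔ ∃ i, ∀ j, j ≠ i → rejectTime Q P (H j) (c j) ω ≤ x := by
  constructor
  · intro h
    obtain ⟨i, hi⟩ := exists_eq_ciInf_of_finite
      (f := fun i => ⨆ j, ⨆ (_ : j ≠ i), rejectTime Q P (H j) (c j) ω)
    refine ⟨i, fun j hj => ?_⟩
    rw [waldTime, ← hi] at h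
    exact (le_iSup₂ (f := fun j (_ : j ≠ i) => rejectTime Q P (H j) (c j) ω) j hj).trans h
  · rintro ⟨i, hi⟩
    exact (iInf_le _ i).trans (iSup₂_le hi)

theorem waldTime_mono {c' : ι → ℝ} (h : ∀ i, c i ≤ c' i) :
    waldTime Q P H c ω ≤ waldTime Q P H c' ω :=
  iInf_mono fun _ => iSup₂_mono fun j _ => rejectTime_mono (h j)

variable (Q P H c) in
theorem isStoppingTime_waldTime [Finite ι] [Nonempty ι] :
    IsStoppingTime (obsFiltration S) (waldTime Q P H c) := by
  intro n
  have h : {ω | waldTime Q P H c ω ≤ (n : ℕ∞)} =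
      ⋃ i, ⋂ j, ⋂ (_ : j ≠ i), {ω | rejectTime Q P (H j) (c j) ω ≤ (n : ℕ∞)} := by
    ext ω
    simp only [Set.mem_ofPred_eq, waldTime_le_iff, Set.mem_iUnion, Set.mem_iInter]
  change MeasurableSet[obsFiltration S n] {ω | waldTime Q P H c ω ≤ (n : ℕ∞)}
  rw [h]
  exact MeasurableSet.iUnion fun i => MeasurableSet.iInter fun j => MeasurableSet.iInter fun _ =>
    isStoppingTime_rejectTime Q P (H j) (c j) n

/-- Nothing is known about `sel`, but it sees `ω` only through the set of maximizers, which takes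
finitely many values; the event is split along them. -/
theorem measurableSet_sel_filter_eq [Fintype ι] {Ω : Type*} {m : MeasurableSpace Ω}
    (sel : Finset ι → ι) (p : ι → ι → Ω → Prop) [∀ ω, DecidablePred fun k => ∀ j, p j k ω]
    (hp : ∀ j k, MeasurableSet {ω | p j k ω}) (i : ι) :
    MeasurableSet {ω | sel (Finset.univ.filter fun k => ∀ j, p j k ω) = i} := by
  have h : {ω | sel (Finset.univ.filter fun k => ∀ j, p j k ω) = i} =
      ⋃ s ∈ {s : Finset ι | sel s = i}, ⋂ k, {ω | (∀ j, p j k ω) ↔ k ∈ s} := by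
    ext ω
    simp only [Set.mem_ofPred_eq, Set.mem_iUnion, Set.mem_iInter, exists_prop]
    constructor
    · intro h
      exact ⟨_, h, fun k => by simp⟩
    · rintro ⟨s, hs, h⟩
      rw [← hs]
      congr 1
      ext k
      simp [h k]
  rw [h]
  refine MeasurableSet.biUnion (Set.to_countable _) fun s _ => MeasurableSet.iInter fun k => ?_
  have h1 : MeasurableSet {ω | ∀ j, p j k ω} := by
    have : {ω | ∀ j, p j k ω} = ⋂ j, {ω | p j k ω} := by
      ext ω
      simp
    rw [this]
    exact MeasurableSet.iInter fun j => hp j k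
  by_cases hk : k ∈ s
  · simpa [hk] using h1
  · simp only [hk, iff_false]
    exact h1.compl

theorem rejectTime_le_rejectTime_iff {j k : ι} :
    rejectTime Q P (H j) (c j) ω ≤ rejectTime Q P (H k) (c k) ω ↔
      ∀ n : ℕ, rejectTime Q P (H k) (c k) ω ≤ n → rejectTime Q P (H j) (c j) ω ≤ n := by
  refine ⟨fun h n hn => h.trans hn, fun h => ?_⟩
  by_cases hk : rejectTime Q P (H k) (c k) ω = ⊤
  · rw [hk]
    exact le_top
  · obtain ⟨n, hn⟩ := ENat.ne_top_iff_exists.1 hk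
    rw [← hn]
    exact h n hn.ge

/-- Before the observation time of Wald's test has passed, its decision depends on the rejecting
times up to the present only. -/
theorem rejectTime_le_rejectTime_iff_of_waldTime_le [Finite ι] [Nonempty ι] {n : ℕ}
    (hn : waldTime Q P H c ω ≤ n) (j k : ι) :
    rejectTime Q P (H j) (c j) ω ≤ rejectTime Q P (H k) (c k) ω ↔
      ∀ m ≤ n, rejectTime Q P (H k) (c k) ω ≤ m → rejectTime Q P (H j) (c j) ω ≤ m := by
  refine ⟨fun h m _ hm => h.trans hm, fun h => ?_⟩
  obtain ⟨i, hi⟩ := waldTime_le_iff.1 hn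
  by_cases hk : rejectTime Q P (H k) (c k) ω ≤ n
  · obtain ⟨m, hm⟩ := ENat.ne_top_iff_exists.1 (hk.trans_lt (ENat.natCast_lt_top n)).ne
    rw [← hm] at hk ⊢
    exact h m (by exact_mod_cast hk) hm.ge
  -- If `k` is not rejected by time `n`, it is the index spared by the test, and all others are
  -- rejected by then.
  · rcases eq_or_ne j k with rfl | hjk
    · exact le_rfl
    · have hki : k = i := by
        by_contra hne
        exact hk (hi k hne)
      exact (hi j (hki ▸ hjk)).trans (not_le.1 hk).le

theorem measurableSet_waldDecision_eq [Fintype ι] [Nonempty ι] (sel : Finset ι → ι) (i : ι) :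
    MeasurableSet[(isStoppingTime_waldTime Q P H c).measurableSpace]
      {ω | waldDecision sel Q P H c ω = i} := by
  classical
  -- The stopped σ-field asks for two things: measurability in the join of all `ℱ n`, which covers
  -- `τ = ∞`, and measurability in `ℱ n` on `τ ≤ n`. In the second case the maximizers must be
  -- expressed through the past up to `n`.
  refine ⟨?_, fun n => ?_⟩
  · refine measurableSet_sel_filter_eq (m := ⨆ n, (obsFiltration S n : MeasurableSpace (ℕ → S)))
      sel (fun j k ω => rejectTime Q P (H j) (c j) ω ≤ rejectTime Q P (H k) (c k) ω)
      (fun j k => ?_) i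
    have h : {ω | rejectTime Q P (H j) (c j) ω ≤ rejectTime Q P (H k) (c k) ω} =
        ⋂ n : ℕ, {ω | rejectTime Q P (H k) (c k) ω ≤ n}ᶜ ∪
          {ω | rejectTime Q P (H j) (c j) ω ≤ n} := by
      ext ω
      simp only [Set.mem_ofPred_eq, rejectTime_le_rejectTime_iff, Set.mem_iInter, Set.mem_union,
        Set.mem_compl_iff, imp_iff_not_or]
    rw [h]
    have hle : ∀ (l : ι) (n : ℕ), MeasurableSet[⨆ n, (obsFiltration S n : MeasurableSpace (ℕ → S))]
        {ω | rejectTime Q P (H l) (c l) ω ≤ n} := fun l n =>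
      le_iSup (fun n => (obsFiltration S n : MeasurableSpace (ℕ → S))) n _
        (isStoppingTime_rejectTime Q P (H l) (c l) n)
    exact MeasurableSet.iInter fun n => (hle k n).compl.union (hle j n)
  · have h : {ω | waldDecision sel Q P H c ω = i} ∩ {ω | waldTime Q P H c ω ≤ (n : ℕ∞)} =
        {ω | sel (Finset.univ.filter fun k => ∀ j, ∀ m ≤ n,
          rejectTime Q P (H k) (c k) ω ≤ m → rejectTime Q P (H j) (c j) ω ≤ m) = i} ∩
          {ω | waldTime Q P H c ω ≤ (n : ℕ∞)} := by
      ext ω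
      simp only [Set.mem_inter_iff, Set.mem_ofPred_eq, waldDecision]
      refine and_congr_left fun hn => ?_
      simp only [rejectTime_le_rejectTime_iff_of_waldTime_le hn]
    change MeasurableSet[obsFiltration S n]
      ({ω | waldDecision sel Q P H c ω = i} ∩ {ω | waldTime Q P H c ω ≤ (n : ℕ∞)})
    rw [h]
    refine MeasurableSet.inter ?_ (isStoppingTime_waldTime Q P H c n)
    refine measurableSet_sel_filter_eq (m := (obsFiltration S n : MeasurableSpace (ℕ → S))) sel (fun j k ω => ∀ m ≤ n,
      rejectTime Q P (H k) (c k) ω ≤ m → rejectTime Q P (H j) (c j) ω ≤ m) (fun j k => ?_) i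
    have h' : {ω | ∀ m ≤ n, rejectTime Q P (H k) (c k) ω ≤ m →
        rejectTime Q P (H j) (c j) ω ≤ m} =
        ⋂ m ∈ Finset.range (n + 1), {ω | rejectTime Q P (H k) (c k) ω ≤ m}ᶜ ∪
          {ω | rejectTime Q P (H j) (c j) ω ≤ m} := by
      ext ω
      simp only [Set.mem_ofPred_eq, Set.mem_iInter, Set.mem_union,
        Set.mem_compl_iff, imp_iff_not_or, Finset.mem_range, Nat.lt_succ_iff]
    rw [h']
    have hle : ∀ (l : ι), ∀ m ∈ Finset.range (n + 1), MeasurableSet[obsFiltration S n]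
        {ω | rejectTime Q P (H l) (c l) ω ≤ m} := fun l m hm =>
      (obsFiltration S).mono (Nat.lt_succ_iff.1 (Finset.mem_range.1 hm)) _
        (isStoppingTime_rejectTime Q P (H l) (c l) m)
    exact Finset.measurableSet_biInter _ fun m hm => (hle k m hm).compl.union (hle j m hm)

/-- If `H i` were never rejected although the test stops, all other rejecting times would be finite.
Then `i` would be the only maximizer, and `sel` would have to pick it. -/
theorem rejectTime_lt_top_of_waldDecision_ne [Fintype ι] [Nonempty ι] {sel : Finset ι → ι}
    (hsel : ∀ s : Finset ι, s.Nonempty → sel s ∈ s) {i : ι} (hτ : waldTime Q P H c ω < ⊤)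
    (hd : waldDecision sel Q P H c ω ≠ i) : rejectTime Q P (H i) (c i) ω < ⊤ := by
  classical
  by_contra hi
  rw [not_lt_top_iff] at hi
  obtain ⟨k, hk⟩ := waldTime_le_iff.1 (le_refl (waldTime Q P H c ω))
  have hki : i = k := by
    by_contra hne
    exact absurd hi ((hk i hne).trans_lt hτ).ne
  subst hki
  have hmem := hsel (Finset.univ.filter fun k =>
    ∀ j, rejectTime Q P (H j) (c j) ω ≤ rejectTime Q P (H k) (c k) ω)
    ⟨i, by simp [hi]⟩
  rw [Finset.mem_filter] at hmem
  have h1 := hmem.2 i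
  rw [hi, top_le_iff] at h1
  by_contra _
  have hne : sel (Finset.univ.filter fun k =>
    ∀ j, rejectTime Q P (H j) (c j) ω ≤ rejectTime Q P (H k) (c k) ω) ≠ i := by
    intro h
    refine hd ?_
    rw [waldDecision, ← h]
  exact absurd h1 ((hk _ hne).trans_lt hτ).ne

/-- Wald's test at the level `1 / a` has error probabilities at most `a`. -/
theorem errorsAtMost_waldTime [Fintype ι] [Nonempty ι] [IsProbabilityMeasure Q]
    [IsProbabilityMeasure P] [∀ i, IsProbabilityMeasure (H i)] {sel : Finset ι → ι}
    (hsel : ∀ s : Finset ι, s.Nonempty → sel s ∈ s) (hP : ∀ i n, restr P n ≪ restr (H i) n)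
    (hQ : ∀ i n, restr (H i) n ≪ restr Q n) {a : ι → ℝ} (ha : ∀ i, 0 < a i) :
    ErrorsAtMost H a (waldTime Q P H fun i => (a i)⁻¹)
      (waldDecision sel Q P H fun i => (a i)⁻¹) := by
  intro i
  have h := measure_rejectTime_lt_top_le (hP i) (hQ i) (inv_pos.2 (ha i))
  rw [inv_inv] at h
  refine (measure_mono ?_).trans h
  rintro ω ⟨h1, h2⟩
  exact rejectTime_lt_top_of_waldDecision_ne hsel h1 h2

end WaldTime

/-- `ℱ 0` is trivial. This serves rules that stop at time 0, where rejecting times, which start at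
1, say nothing about the likelihood ratio. -/
theorem measure_eq_of_measurableSet_zero {P μ : Measure (ℕ → S)} [IsProbabilityMeasure P]
    [IsProbabilityMeasure μ] {A : Set (ℕ → S)} (hA : MeasurableSet[obsFiltration S 0] A) :
    P A = μ A := by
  obtain ⟨B, _, rfl⟩ := hA
  by_cases h : (fun k : Fin 0 => k.elim0) ∈ B
  · have : (fun (ω : ℕ → S) (k : Fin 0) => ω k) ⁻¹' B = Set.univ := by
      ext ω
      simp only [Set.mem_preimage, Set.mem_univ, iff_true]
      convert h
    rw [this, measure_univ, measure_univ]
  · have : (fun (ω : ℕ → S) (k : Fin 0) => ω k) ⁻¹' B = ∅ := by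
      ext ω
      simp only [Set.mem_preimage, Set.mem_empty_iff_false, iff_false]
      intro h'
      refine h ?_
      convert h'
    rw [this, measure_empty, measure_empty]

/-- A decision rule with error probabilities at most `a` rarely stops before Wald's test at a level
much below `1 / a`. -/
theorem measure_lt_waldTime_le [Fintype ι] [Nonempty ι] {Q P : Measure (ℕ → S)}
    {H : ι → Measure (ℕ → S)} [IsProbabilityMeasure Q]
    [IsProbabilityMeasure P] [∀ i, IsProbabilityMeasure (H i)]
    (hP : ∀ i n, restr P n ≪ restr (H i) n)
    (hQ : ∀ i n, restr (H i) n ≪ restr Q n) {a c : ι → ℝ} (hc : ∀ i, 1 ≤ c i)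
    {σ : (ℕ → S) → ℕ∞} (hσ : σ ∈ timeClass P H a) :
    P {ω | σ ω < waldTime Q P H c ω} ≤ ∑ i, ENNReal.ofReal (c i * a i) := by
  obtain ⟨d, ⟨hst, -, hd⟩, herr⟩ := hσ
  have hsub : {ω | σ ω < waldTime Q P H c ω} ⊆
      ⋃ i, {ω | σ ω < ⊤ ∧ ω ∈ {ω | d ω ≠ i ∧ σ ω < rejectTime Q P (H i) (c i) ω}} := by
    intro ω hω
    -- Sparing the index `d ω` does not complete Wald's test by time `σ ω`, so some `j ≠ d ω` is
    -- still unrejected. This makes `d ω` an error under `H j`.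
    rw [Set.mem_ofPred_eq, ← not_le, waldTime_le_iff] at hω
    push Not at hω
    obtain ⟨j, hj, hlt⟩ := hω (d ω)
    exact Set.mem_iUnion.2 ⟨j, hlt.trans_le le_top, hj.symm, hlt⟩
  refine (measure_mono hsub).trans ((measure_iUnion_fintype_le _ _).trans ?_)
  refine Finset.sum_le_sum fun i _ => ?_
  have hci : 0 ≤ c i := zero_le_one.trans (hc i)
  have hmeasd : ∀ n : ℕ, MeasurableSet[obsFiltration S n] ({ω | d ω ≠ i} ∩ {ω | σ ω = n}) := by
    intro n
    refine (hst.measurableSet_inter_eq_iff _ n).1 ?_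
    refine MeasurableSet.inter (hd i).compl ?_
    have h := (hst.measurableSet_inter_eq_iff Set.univ n).2
    rw [Set.univ_inter] at h
    exact h (measurableSet_eq_natCast hst n)
  have hmeas : ∀ n : ℕ, MeasurableSet[obsFiltration S n]
      ({ω | d ω ≠ i ∧ σ ω < rejectTime Q P (H i) (c i) ω} ∩ {ω | σ ω = n}) := by
    intro n
    have h : {ω | d ω ≠ i ∧ σ ω < rejectTime Q P (H i) (c i) ω} ∩ {ω | σ ω = n} =
        ({ω | d ω ≠ i} ∩ {ω | σ ω = n}) ∩ {ω | rejectTime Q P (H i) (c i) ω ≤ n}ᶜ := by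
      ext ω
      simp only [Set.mem_inter_iff, Set.mem_ofPred_eq, Set.mem_compl_iff, not_le]
      constructor
      · rintro ⟨⟨h1, h2⟩, h3⟩
        exact ⟨⟨h1, h3⟩, h3 ▸ h2⟩
      · rintro ⟨⟨h1, h3⟩, h2⟩
        exact ⟨⟨h1, h3 ▸ h2⟩, h3⟩
    rw [h]
    exact (hmeasd n).inter (isStoppingTime_rejectTime Q P (H i) (c i) n).compl
  rw [measure_lt_top_and_eq_tsum P hmeas, ENNReal.ofReal_mul hci]
  refine le_trans ?_ (mul_le_mul_right (herr i) _)
  rw [show {ω | σ ω < ⊤ ∧ d ω ≠ i} = {ω | σ ω < ⊤ ∧ ω ∈ {ω | d ω ≠ i}} from rfl,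
    measure_lt_top_and_eq_tsum (H i) hmeasd, ← ENNReal.tsum_mul_left]
  refine ENNReal.tsum_le_tsum fun n => ?_
  refine le_trans ?_ (mul_le_mul_right (measure_mono (μ := H i) (s :=
    {ω | d ω ≠ i ∧ σ ω < rejectTime Q P (H i) (c i) ω} ∩ {ω | σ ω = n}) ?_) _)
  -- At `n = 0` all laws agree and `1 ≤ c i` suffices; later, an unrejected `H i` has likelihood
  -- ratio below `c i`.
  · rcases Nat.eq_zero_or_pos n with rfl | hn
    · rw [measure_eq_of_measurableSet_zero (P := P) (μ := H i) (hmeas 0)]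
      exact le_mul_of_one_le_left zero_le (ENNReal.one_le_ofReal.2 (hc i))
    · refine measure_le_mul_of_likelihoodRatio_le Q P (H i) n (hP i n) (hQ i n) (hmeas n) _ ?_
      rintro ω ⟨⟨_, h2⟩, h3⟩
      rw [Set.mem_ofPred_eq] at h3
      rw [h3] at h2
      exact (natCast_lt_rejectTime_iff.1 h2 n hn le_rfl).le
  · rintro ω ⟨⟨h1, _⟩, h3⟩
    exact ⟨h1, h3⟩

end

/-! ### Random-walk estimates for a single rejecting time -/

section


theorem measureReal_le_of_ae_imp {Ω : Type*} [MeasurableSpace Ω] {ν : Measure Ω} [IsFiniteMeasure ν]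
    {A B : Set Ω} (h : ∀ᵐ ω ∂ν, ω ∈ A → ω ∈ B) : ν.real A ≤ ν.real B :=
  ENNReal.toReal_mono (measure_ne_top _ _) (measure_mono_ae h)

variable {S : Type*} [MeasurableSpace S]

/-- Under the i.i.d. law `ν`, the likelihood ratio of `P` to `μ` is the product of the likelihood
ratio of `P` to `ν`, which is at least `w`, with the exponential of a nondegenerate integrable
random walk with steps `f`, where `exp (-f)` is a probability density. -/
structure IsWalkRatio (Q P ν μ : Measure (ℕ → S)) (w : ℝ) (f : S → ℝ) : Prop where
  iid : IsIIDLaw ν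
  locallyEquivalent : LocallyEquivalent P ν
  absolutelyContinuous : ∀ n, restr ν n ≪ restr Q n
  pos : 0 < w
  measurable : Measurable f
  ratio : ∀ᵐ ω ∂ν, ∀ n, w ≤ likelihoodRatio Q P ν n ω ∧
    likelihoodRatio Q P μ n ω =
      likelihoodRatio Q P ν n ω * Real.exp (∑ m ∈ Finset.range n, f (ω m))
  integrable_exp : Integrable (fun ω => Real.exp (-f (ω 0))) ν
  integral_exp : ∫ ω, Real.exp (-f (ω 0)) ∂ν = 1
  nondegenerate : ∀ c : ℝ, ¬ ∀ᵐ ω ∂ν, f (ω 0) = c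
  integrable : Integrable (fun ω => f (ω 0)) ν

/-- The affinity of `ν` and the law with density `exp (-f)`. -/
noncomputable def affinity (ν : Measure (ℕ → S)) (f : S → ℝ) : ℝ :=
  mgf (fun ω => f (ω 0)) ν (-1 / 2)

namespace IsWalkRatio

variable {Q P ν μ : Measure (ℕ → S)} {w : ℝ} {f : S → ℝ}

theorem measurable_comp_eval (h : IsWalkRatio Q P ν μ w f) (n : ℕ) :
    Measurable fun ω : ℕ → S => f (ω n) :=
  h.measurable.comp (measurable_pi_apply n)

theorem identDistrib (h : IsWalkRatio Q P ν μ w f) (n : ℕ) :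
    IdentDistrib (fun ω : ℕ → S => f (ω n)) (fun ω => f (ω 0)) ν ν :=
  (h.iid.2 n).comp h.measurable

theorem iIndepFun (h : IsWalkRatio Q P ν μ w f) :
    ProbabilityTheory.iIndepFun (fun (n : ℕ) (ω : ℕ → S) => f (ω n)) ν :=
  h.iid.1.comp (fun _ => f) fun _ => h.measurable

theorem affinity_nonneg : 0 ≤ affinity ν f := mgf_nonneg

variable [IsProbabilityMeasure ν]

theorem integrable_exp_half (h : IsWalkRatio Q P ν μ w f) :
    Integrable (fun ω => Real.exp (-1 / 2 * f (ω 0))) ν := by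
  refine Integrable.mono' (h.integrable_exp.add (integrable_const 1))
    ((h.measurable_comp_eval 0).const_mul _).exp.aestronglyMeasurable (ae_of_all _ fun ω => ?_)
  rw [Real.norm_eq_abs, abs_of_pos (Real.exp_pos _), Pi.add_apply]
  have h1 : Real.exp (-f (ω 0)) = Real.exp (-1 / 2 * f (ω 0)) ^ 2 := by
    rw [← Real.exp_nat_mul]
    congr 1
    push_cast
    ring
  rw [h1]
  nlinarith [sq_nonneg (Real.exp (-1 / 2 * f (ω 0)) - 1), Real.exp_pos (-1 / 2 * f (ω 0))]

/-- The integral of `(1 - exp (-f / 2)) ^ 2` is `2 - 2 * affinity ν f`. It is nonnegative, and zero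
only if `f = 0` almost surely, which nondegeneracy excludes. -/
theorem affinity_lt_one (h : IsWalkRatio Q P ν μ w f) : affinity ν f < 1 := by
  have hsq : ∀ ω : ℕ → S, (1 - Real.exp (-1 / 2 * f (ω 0))) ^ 2 =
      1 - 2 * Real.exp (-1 / 2 * f (ω 0)) + Real.exp (-f (ω 0)) := by
    intro ω
    have h1 : Real.exp (-f (ω 0)) = Real.exp (-1 / 2 * f (ω 0)) ^ 2 := by
      rw [← Real.exp_nat_mul]
      congr 1
      push_cast
      ring
    rw [h1]
    ring
  have hi := h.integrable_exp_half
  have hint : Integrable (fun ω => (1 - Real.exp (-1 / 2 * f (ω 0))) ^ 2) ν := by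
    simp_rw [hsq]
    exact ((integrable_const 1).sub (hi.const_mul 2)).add h.integrable_exp
  have heq : ∫ ω, (1 - Real.exp (-1 / 2 * f (ω 0))) ^ 2 ∂ν = 2 - 2 * affinity ν f := by
    have h1 : Integrable (fun ω : ℕ → S => 1 - 2 * Real.exp (-1 / 2 * f (ω 0))) ν :=
      (integrable_const 1).sub (hi.const_mul 2)
    simp_rw [hsq]
    rw [integral_add h1 h.integrable_exp,
      integral_sub (integrable_const 1) (hi.const_mul 2), integral_const_mul, h.integral_exp,
      affinity, mgf, integral_const, probReal_univ, one_smul]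
    ring
  have hnn : 0 ≤ ∫ ω, (1 - Real.exp (-1 / 2 * f (ω 0))) ^ 2 ∂ν :=
    integral_nonneg fun ω => sq_nonneg _
  refine lt_of_le_of_ne (by linarith) fun hone => h.nondegenerate 0 ?_
  rw [hone, show (2 : ℝ) - 2 * 1 = 0 by norm_num,
    integral_eq_zero_iff_of_nonneg (fun ω => sq_nonneg _) hint] at heq
  filter_upwards [heq] with ω hω
  simp only [Pi.zero_apply] at hω
  have h1 : Real.exp (-1 / 2 * f (ω 0)) = 1 := by
    have := pow_eq_zero_iff two_ne_zero |>.1 hω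
    linarith
  rw [Real.exp_eq_one_iff] at h1
  linarith

/-- Chernoff's bound at exponent `-1 / 2`, where the moment generating function of a step is the
affinity. -/
theorem measureReal_sum_le (h : IsWalkRatio Q P ν μ w f) (s : Finset ℕ) (x : ℝ) :
    ν.real {ω | ∑ k ∈ s, f (ω k) ≤ x} ≤ Real.exp (x / 2) * affinity ν f ^ s.card := by
  have hint : ∀ k, Integrable (fun ω : ℕ → S => Real.exp (-1 / 2 * f (ω k))) ν := fun k =>
    ((h.identDistrib k).comp (u := fun y => Real.exp (-1 / 2 * y))
      (by fun_prop)).integrable_iff.2 h.integrable_exp_half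
  have h1 := measure_le_le_exp_mul_mgf (μ := ν) (X := ∑ k ∈ s, fun ω : ℕ → S => f (ω k))
    (t := -1 / 2) x (by norm_num)
    (h.iIndepFun.integrable_exp_mul_sum h.measurable_comp_eval fun k _ => hint k)
  rw [h.iIndepFun.mgf_sum h.measurable_comp_eval, Finset.prod_congr rfl fun k _ =>
    congrFun (mgf_congr_identDistrib (h.identDistrib k)) _, Finset.prod_const] at h1
  simp only [Finset.sum_apply] at h1
  refine h1.trans (le_of_eq ?_)
  rw [affinity]
  congr 2
  ring

/-- Union bound over the starting point `m`. The Chernoff bounds form a geometric series, so the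
estimate is uniform in `n`: the walk rarely ends far below one of its earlier values. -/
theorem measureReal_exists_sum_Ico_le (h : IsWalkRatio Q P ν μ w f) (n : ℕ) (x : ℝ) :
    ν.real {ω | ∃ m ≤ n, ∑ k ∈ Finset.Ico m n, f (ω k) ≤ x} ≤
      Real.exp (x / 2) * (1 - affinity ν f)⁻¹ := by
  have hset : {ω : ℕ → S | ∃ m ≤ n, ∑ k ∈ Finset.Ico m n, f (ω k) ≤ x} =
      ⋃ m ∈ Finset.range (n + 1), {ω | ∑ k ∈ Finset.Ico m n, f (ω k) ≤ x} := by
    ext ω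
    simp
  rw [hset]
  calc _ ≤ ∑ m ∈ Finset.range (n + 1), ν.real {ω | ∑ k ∈ Finset.Ico m n, f (ω k) ≤ x} :=
        measureReal_biUnion_finset_le _ _
    _ ≤ ∑ m ∈ Finset.range (n + 1), Real.exp (x / 2) * affinity ν f ^ (n - m) := by
        refine Finset.sum_le_sum fun m _ => ?_
        have := h.measureReal_sum_le (Finset.Ico m n) x
        rwa [Nat.card_Ico] at this
    _ = Real.exp (x / 2) * ∑ m ∈ Finset.range (n + 1), affinity ν f ^ m := by
        rw [← Finset.mul_sum, Finset.sum_flip fun m => affinity ν f ^ m]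
    _ ≤ _ := by
        refine mul_le_mul_of_nonneg_left ?_ (Real.exp_pos _).le
        rw [← tsum_geometric_of_lt_one affinity_nonneg h.affinity_lt_one]
        exact (summable_geometric_of_lt_one affinity_nonneg h.affinity_lt_one).sum_le_tsum _
          fun _ _ => pow_nonneg affinity_nonneg _

theorem measureReal_natCast_lt_rejectTime_le (h : IsWalkRatio Q P ν μ w f) {c : ℝ} (hc : 0 < c)
    {n : ℕ} (hn : 1 ≤ n) :
    ν.real {ω | (n : ℕ∞) < rejectTime Q P μ c ω} ≤
      Real.exp (Real.log (c / w) / 2) * affinity ν f ^ n := by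
  have h1 := h.measureReal_sum_le (Finset.range n) (Real.log (c / w))
  rw [Finset.card_range] at h1
  refine (measureReal_le_of_ae_imp ?_).trans h1
  filter_upwards [h.ratio] with ω hω hlt
  rw [natCast_lt_rejectTime_iff] at hlt
  have h2 := hlt n hn le_rfl
  rw [(hω n).2] at h2
  rw [Real.le_log_iff_exp_le (div_pos hc h.pos), le_div_iff₀ h.pos, mul_comm]
  exact (mul_le_mul_of_nonneg_right (hω n).1 (Real.exp_pos _).le).trans h2.le

variable [IsProbabilityMeasure Q] [IsProbabilityMeasure P]

theorem measureReal_rejectTime_self_lt_top_le (h : IsWalkRatio Q P ν μ w f) {c : ℝ} (hc : 0 < c) :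
    ν.real {ω | rejectTime Q P ν c ω < ⊤} ≤ c⁻¹ := by
  have h1 := measure_rejectTime_lt_top_le (fun n => (h.locallyEquivalent n).1)
    h.absolutelyContinuous hc
  exact ENNReal.toReal_le_of_le_ofReal (inv_pos.2 hc).le h1

/-- The ratio of `P` to `μ` is the product of the ratio of `P` to `ν` and the exponential of the
walk. To reach `c`, one of the factors must reach `√c`. Ville's inequality handles the first,
Markov's inequality for the sum of the `|f|` the second. -/
theorem measureReal_rejectTime_le_natCast_le (h : IsWalkRatio Q P ν μ w f) {c : ℝ} (hc : 1 < c)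
    (n : ℕ) :
    ν.real {ω | rejectTime Q P μ c ω ≤ n} ≤
      (√c)⁻¹ + 2 * n * (∫ ω, |f (ω 0)| ∂ν) / Real.log c := by
  have hlog : 0 < Real.log c := Real.log_pos hc
  have hc0 : 0 < c := zero_lt_one.trans hc
  have h1 := h.measureReal_rejectTime_self_lt_top_le (Real.sqrt_pos.2 hc0)
  have habs : ∀ k, Integrable (fun ω : ℕ → S => |f (ω k)|) ν := fun k =>
    ((h.identDistrib k).integrable_iff.2 h.integrable).abs
  have h2 : ν.real {ω | Real.log c / 2 ≤ ∑ k ∈ Finset.range n, |f (ω k)|} ≤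
      2 * n * (∫ ω, |f (ω 0)| ∂ν) / Real.log c := by
    have h3 := mul_meas_ge_le_integral_of_nonneg (μ := ν)
      (f := fun ω => ∑ k ∈ Finset.range n, |f (ω k)|)
      (ae_of_all _ fun ω => Finset.sum_nonneg fun _ _ => abs_nonneg _)
      (integrable_finsetSum _ fun k _ => habs k) (Real.log c / 2)
    have h4 : ∀ k, ∫ ω : ℕ → S, |f (ω k)| ∂ν = ∫ ω : ℕ → S, |f (ω 0)| ∂ν := fun k =>
      ((h.identDistrib k).comp (u := fun y => |y|) (by fun_prop)).integral_eq
    rw [integral_finsetSum _ fun k _ => habs k, Finset.sum_congr rfl fun k _ => h4 k,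
      Finset.sum_const, Finset.card_range, nsmul_eq_mul] at h3
    rw [le_div_iff₀ hlog]
    linarith
  refine (measureReal_le_of_ae_imp (B := {ω | rejectTime Q P ν (√c) ω < ⊤} ∪
    {ω | Real.log c / 2 ≤ ∑ k ∈ Finset.range n, |f (ω k)|}) ?_).trans
    ((measureReal_union_le _ _).trans (add_le_add h1 h2))
  filter_upwards [h.ratio] with ω hω hle
  rw [rejectTime_le_natCast_iff] at hle
  obtain ⟨m, hm1, hmn, hm⟩ := hle
  by_cases hbig : √c ≤ likelihoodRatio Q P ν m ω
  · exact Or.inl (rejectTime_lt_top_iff.2 ⟨m, hm1, hbig⟩)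
  · right
    rw [not_le] at hbig
    rw [(hω m).2] at hm
    have h3 : √c ≤ Real.exp (∑ k ∈ Finset.range m, f (ω k)) := by
      have h4 : √c * √c ≤ √c * Real.exp (∑ k ∈ Finset.range m, f (ω k)) := by
        rw [Real.mul_self_sqrt hc0.le]
        exact hm.trans (mul_le_mul_of_nonneg_right hbig.le (Real.exp_pos _).le)
      exact le_of_mul_le_mul_left h4 (Real.sqrt_pos.2 hc0)
    rw [← Real.log_le_iff_le_exp (Real.sqrt_pos.2 hc0), Real.log_sqrt hc0.le] at h3
    calc Real.log c / 2 ≤ _ := h3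
      _ ≤ ∑ k ∈ Finset.range m, |f (ω k)| := Finset.sum_le_sum fun _ _ => le_abs_self _
      _ ≤ _ := Finset.sum_le_sum_of_subset_of_nonneg (Finset.range_subset_range.2 hmn)
          fun _ _ _ => abs_nonneg _

/-- Let level `exp (-b) * c` be reached at some `m ≤ n`, and `c` not by `n`. Unless the ratio of `P`
to `ν` exceeds `exp B` or the walk falls by `B` from `m` to `n`, the walk at `n` is at least `log c
- b - 2 * B`; the bound `w` on that ratio keeps it below `log c - log w`. The length of this
interval does not depend on `c` or `n`. -/
theorem exists_measureReal_rejectTime_le_and_lt_le (h : IsWalkRatio Q P ν μ w f) (b : ℝ) {ε : ℝ}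
    (hε : 0 < ε) :
    ∃ c₀ : ℝ, ∀ c ≥ c₀, ∀ n : ℕ,
      ν.real {ω | rejectTime Q P μ (Real.exp (-b) * c) ω ≤ n ∧
        (n : ℕ∞) < rejectTime Q P μ c ω} ≤ ε := by
  have hρ := h.affinity_lt_one
  have hρ' : 0 < (1 - affinity ν f)⁻¹ := inv_pos.2 (by linarith)
  obtain ⟨B, hB1, hB2⟩ : ∃ B : ℝ, (Real.exp B)⁻¹ ≤ ε / 3 ∧
      Real.exp (-B / 2) * (1 - affinity ν f)⁻¹ ≤ ε / 3 := by
    have t1 : Tendsto (fun B : ℝ => (Real.exp B)⁻¹) atTop (𝓝 0) :=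
      tendsto_inv_atTop_zero.comp Real.tendsto_exp_atTop
    have t2 : Tendsto (fun B : ℝ => Real.exp (-B / 2) * (1 - affinity ν f)⁻¹) atTop (𝓝 0) := by
      have t3 : Tendsto (fun B : ℝ => -B / 2) atTop atBot := by
        simp_rw [neg_div]
        exact tendsto_neg_atTop_atBot.comp (tendsto_id.atTop_div_const two_pos)
      simpa using (Real.tendsto_exp_atBot.comp t3).mul_const (1 - affinity ν f)⁻¹
    exact ((t1.eventually (eventually_le_nhds (by positivity))).and
      (t2.eventually (eventually_le_nhds (by positivity)))).exists
  obtain ⟨N, hN⟩ := exists_forall_measureReal_sum_mem_Icc_le ν (fun k (ω : ℕ → S) => f (ω k))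
    h.measurable_comp_eval h.iIndepFun h.identDistrib h.nondegenerate (b + 2 * B - Real.log w)
    (show 0 < ε / 3 by positivity)
  have hsmall : Tendsto (fun c : ℝ => (√c)⁻¹ + 2 * N * (∫ ω, |f (ω 0)| ∂ν) / Real.log c) atTop
      (𝓝 0) := by
    have t1 : Tendsto (fun c : ℝ => (√c)⁻¹) atTop (𝓝 0) :=
      tendsto_inv_atTop_zero.comp Real.tendsto_sqrt_atTop
    have t2 : Tendsto (fun c : ℝ => 2 * N * (∫ ω, |f (ω 0)| ∂ν) / Real.log c) atTop (𝓝 0) :=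
      tendsto_const_nhds.div_atTop Real.tendsto_log_atTop
    simpa using t1.add t2
  have hscale : Tendsto (fun c : ℝ => Real.exp (-b) * c) atTop atTop :=
    tendsto_id.const_mul_atTop (Real.exp_pos _)
  obtain ⟨c₀, hc₀⟩ := eventually_atTop.1 (((hsmall.comp hscale).eventually
    (eventually_le_nhds hε)).and ((hscale.eventually_gt_atTop 1).and (eventually_gt_atTop 0)))
  refine ⟨c₀, fun c hc n => ?_⟩
  obtain ⟨hc1, hc2, hc3⟩ := hc₀ c hc
  -- Concentration only helps for `n ≥ N`. Before the fixed time `N`, even the lower level is rarely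
  -- reached once `c` is large.
  rcases le_total n N with hnN | hnN
  · refine le_trans ?_ hc1
    refine le_trans (measureReal_mono ?_) (h.measureReal_rejectTime_le_natCast_le hc2 N)
    rintro ω ⟨hω, -⟩
    exact hω.trans (by exact_mod_cast hnN)
  · have e1 := h.measureReal_rejectTime_self_lt_top_le (Real.exp_pos B)
    have e2 := h.measureReal_exists_sum_Ico_le n (-B)
    have e3 := hN n hnN (Real.log c - b - 2 * B)
    have hsub : ν.real {ω | rejectTime Q P μ (Real.exp (-b) * c) ω ≤ n ∧
        (n : ℕ∞) < rejectTime Q P μ c ω} ≤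
        ν.real (({ω | rejectTime Q P ν (Real.exp B) ω < ⊤} ∪
          {ω | ∃ m ≤ n, ∑ k ∈ Finset.Ico m n, f (ω k) ≤ -B}) ∪
          {ω | ∑ m ∈ Finset.range n, f (ω m) ∈ Set.Icc (Real.log c - b - 2 * B)
            (Real.log c - b - 2 * B + (b + 2 * B - Real.log w))}) := by
      refine measureReal_le_of_ae_imp ?_
      filter_upwards [h.ratio] with ω hω
      rintro ⟨hle, hlt⟩
      obtain ⟨m, hm1, hmn, hm⟩ := rejectTime_le_natCast_iff.1 hle
      have hn := natCast_lt_rejectTime_iff.1 hlt n (hm1.trans hmn) le_rfl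
      rw [(hω n).2] at hn
      rw [(hω m).2] at hm
      by_cases hbig : Real.exp B ≤ likelihoodRatio Q P ν m ω
      · exact Or.inl (Or.inl (rejectTime_lt_top_iff.2 ⟨m, hm1, hbig⟩))
      by_cases hdrop : ∑ k ∈ Finset.Ico m n, f (ω k) ≤ -B
      · exact Or.inl (Or.inr ⟨m, hmn, hdrop⟩)
      right
      rw [not_le] at hbig hdrop
      have h1 : Real.log c - b - B ≤ ∑ k ∈ Finset.range m, f (ω k) := by
        have h2 : Real.exp (-b) * c ≤ Real.exp B * Real.exp (∑ k ∈ Finset.range m, f (ω k)) :=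
          hm.trans (mul_le_mul_of_nonneg_right hbig.le (Real.exp_pos _).le)
        rw [← Real.exp_log hc3, ← Real.exp_add, ← Real.exp_add, Real.exp_le_exp] at h2
        linarith
      have h3 : ∑ k ∈ Finset.range m, f (ω k) + ∑ k ∈ Finset.Ico m n, f (ω k) =
          ∑ k ∈ Finset.range n, f (ω k) := Finset.sum_range_add_sum_Ico _ hmn
      have h4 : ∑ k ∈ Finset.range n, f (ω k) ≤ Real.log c - Real.log w := by
        rw [← Real.log_div hc3.ne' h.pos.ne', Real.le_log_iff_exp_le (div_pos hc3 h.pos),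
          le_div_iff₀ h.pos, mul_comm]
        exact (mul_le_mul_of_nonneg_right (hω n).1 (Real.exp_pos _).le).trans hn.le
      constructor
      · linarith
      · linarith
    refine hsub.trans ((measureReal_union_le _ _).trans ?_)
    have e4 := measureReal_union_le (μ := ν) {ω | rejectTime Q P ν (Real.exp B) ω < ⊤}
      {ω : ℕ → S | ∃ m ≤ n, ∑ k ∈ Finset.Ico m n, f (ω k) ≤ -B}
    linarith

end IsWalkRatio

end

/-! ### Moderate functions and the late part of the `G`-moment -/

section


section Moderate

variable {G : ℝ → ℝ}

theorem IsModerate.exists_le_pow_mul (hG : IsModerate G) :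
    ∃ C : ℝ, 1 ≤ C ∧ ∀ (m : ℕ) (t : ℝ), 0 ≤ t → G (2 ^ m * t) ≤ C ^ m * G t := by
  obtain ⟨C, hC⟩ := hG.doubling
  refine ⟨max C 1, le_max_right _ _, fun m => ?_⟩
  induction m with
  | zero => intro t _; simp
  | succ m ih =>
    intro t ht
    have h1 := ih (2 * t) (by positivity)
    have h2 : G (2 * t) ≤ max C 1 * G t := by
      have := (hC t ht).trans (le_max_left C 1)
      rwa [div_le_iff₀ (hG.pos t ht)] at this
    rw [show (2 : ℝ) ^ (m + 1) * t = 2 ^ m * (2 * t) by ring]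
    refine h1.trans ?_
    rw [pow_succ, mul_assoc]
    exact mul_le_mul_of_nonneg_left h2 (by positivity)

/-- Doubling forces polynomial growth: if `C < 2 ^ p`, then `G n` is at most of order `n ^ p`, which
a geometric factor beats. -/
theorem IsModerate.summable_mul_pow (hG : IsModerate G) {r : ℝ} (hr0 : 0 ≤ r) (hr : r < 1) :
    Summable fun n : ℕ => G (n + 1) * r ^ n := by
  rcases hr0.eq_or_lt with rfl | hr0
  · refine summable_of_ne_finset_zero (s := {0}) fun n hn => ?_
    rw [zero_pow (by simpa using hn), mul_zero]
  obtain ⟨C, hC1, hC⟩ := hG.exists_le_pow_mul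
  obtain ⟨p, hp⟩ := pow_unbounded_of_one_lt C one_lt_two
  have hbound : ∀ n : ℕ, G (n + 1) ≤ G 1 * 2 ^ p * ((n + 1 : ℕ) : ℝ) ^ p := by
    intro n
    set k := Nat.log 2 (n + 1)
    have h1 : ((n + 1 : ℕ) : ℝ) ≤ 2 ^ (k + 1) * 1 := by
      rw [mul_one]
      exact_mod_cast (Nat.lt_pow_succ_log_self one_lt_two (n + 1)).le
    have h2 : (2 : ℝ) ^ k ≤ ((n + 1 : ℕ) : ℝ) := by
      exact_mod_cast Nat.pow_log_le_self 2 n.succ_ne_zero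
    have h3 : G (n + 1) ≤ G (2 ^ (k + 1) * 1) := by
      push_cast at h1
      exact hG.mono (Set.mem_Ici.2 (by positivity)) (Set.mem_Ici.2 (by positivity)) h1
    refine h3.trans ((hC (k + 1) 1 zero_le_one).trans ?_)
    have h4 : C ^ (k + 1) ≤ 2 ^ p * ((n + 1 : ℕ) : ℝ) ^ p :=
      calc C ^ (k + 1) ≤ (2 ^ p) ^ (k + 1) := pow_le_pow_left₀ (by positivity) hp.le _
        _ = 2 ^ p * ((2 : ℝ) ^ k) ^ p := by ring
        _ ≤ _ := by gcongr
    calc C ^ (k + 1) * G 1 ≤ 2 ^ p * ((n + 1 : ℕ) : ℝ) ^ p * G 1 :=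
          mul_le_mul_of_nonneg_right h4 (hG.pos 1 zero_le_one).le
      _ = _ := by ring
  have hs : Summable fun n : ℕ => G 1 * 2 ^ p * r⁻¹ * (((n + 1 : ℕ) : ℝ) ^ p * r ^ (n + 1)) :=
    ((summable_nat_add_iff 1).2 (summable_pow_mul_geometric_of_norm_lt_one (R := ℝ) p
      (r := r) (by rwa [Real.norm_eq_abs, abs_of_pos hr0]))).mul_left _
  refine Summable.of_nonneg_of_le (fun n => ?_) (fun n => ?_) hs
  · exact mul_nonneg (hG.pos _ (by positivity)).le (by positivity)
  · refine (mul_le_mul_of_nonneg_right (hbound n) (by positivity)).trans (le_of_eq ?_)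
    rw [pow_succ]
    field_simp

/-- With this `G`, finiteness of `G`-moments yields the integrability of Wald's time required of a
decision rule. -/
theorem IsModerate.add_one : IsModerate fun t => t + 1 where
  pos t ht := by positivity
  mono := fun s _ t _ h => by simpa using h
  tendsto_atTop := tendsto_atTop_add_const_right _ _ tendsto_id
  doubling := ⟨2, fun t ht => by rw [div_le_iff₀ (by positivity)]; linarith⟩

theorem extend_natCast (G : ℝ → ℝ) (n : ℕ) : extend G (n : ℕ∞) = ENNReal.ofReal (G n) := rfl

theorem IsModerate.extend_mono (hG : IsModerate G) : Monotone (extend G) := by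
  intro x y h
  induction y with
  | top => exact le_top
  | coe n =>
    obtain ⟨m, rfl⟩ := ENat.ne_top_iff_exists.1 (h.trans_lt (ENat.natCast_lt_top n)).ne
    rw [extend_natCast, extend_natCast]
    have hmn : m ≤ n := by exact_mod_cast h
    exact ENNReal.ofReal_le_ofReal (hG.mono (Set.mem_Ici.2 (by positivity))
      (Set.mem_Ici.2 (by positivity)) (by exact_mod_cast hmn))

/-- For finite `x > N` the single term with `n + N = x - 1` suffices. For `x = ∞` the series
diverges, its terms being at least `G 0 > 0`. -/
theorem IsModerate.indicator_extend_le_tsum (hG : IsModerate G) (N : ℕ) (x : ℕ∞) :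
    Set.indicator {x : ℕ∞ | (N : ℕ∞) < x} (extend G) x ≤
      ∑' n : ℕ, ENNReal.ofReal (G ((n + N : ℕ) + 1)) *
        Set.indicator {x : ℕ∞ | ((n + N : ℕ) : ℕ∞) < x} 1 x := by
  by_cases hx : (N : ℕ∞) < x
  · rw [Set.indicator_of_mem (show x ∈ {x : ℕ∞ | (N : ℕ∞) < x} from hx)]
    induction x with
    | top =>
      have h1 : ∑' n : ℕ, ENNReal.ofReal (G 0) ≤
          ∑' n : ℕ, ENNReal.ofReal (G ((n + N : ℕ) + 1)) *
            Set.indicator {x : ℕ∞ | ((n + N : ℕ) : ℕ∞) < x} 1 (⊤ : ℕ∞) := by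
        refine ENNReal.tsum_le_tsum fun n => ?_
        rw [Set.indicator_of_mem (show (⊤ : ℕ∞) ∈ {x : ℕ∞ | ((n + N : ℕ) : ℕ∞) < x} from
          ENat.natCast_lt_top _), Pi.one_apply, mul_one]
        exact ENNReal.ofReal_le_ofReal (hG.mono (Set.mem_Ici.2 le_rfl)
          (Set.mem_Ici.2 (by positivity)) (by positivity))
      rw [ENNReal.tsum_const_eq_top_of_ne_zero (ENNReal.ofReal_pos.2 (hG.pos 0 le_rfl)).ne'] at h1
      exact le_top.trans h1
    | coe k =>
      have hk : N < k := by exact_mod_cast hx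
      refine le_trans ?_ (ENNReal.le_tsum (k - 1 - N))
      have h1 : k - 1 - N + N = k - 1 := by omega
      rw [h1, Set.indicator_of_mem (show (k : ℕ∞) ∈ {x : ℕ∞ | ((k - 1 : ℕ) : ℕ∞) < x} from by
        rw [Set.mem_ofPred_eq]; exact_mod_cast (by omega : k - 1 < k)), Pi.one_apply, mul_one,
        extend_natCast]
      refine ENNReal.ofReal_le_ofReal (le_of_eq ?_)
      congr 1
      exact_mod_cast (by omega : k = k - 1 + 1)
  · rw [Set.indicator_of_notMem (show x ∉ {x : ℕ∞ | (N : ℕ∞) < x} from hx)]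
    exact zero_le

end Moderate

variable {S : Type*} [MeasurableSpace S]

theorem measurable_comp_isStoppingTime {τ : (ℕ → S) → ℕ∞}
    (hτ : IsStoppingTime (obsFiltration S) τ) (F : ℕ∞ → ℝ≥0∞) : Measurable fun ω => F (τ ω) := by
  have hle : ∀ n : ℕ, MeasurableSet {ω | τ ω ≤ n} := fun n => (obsFiltration S).le n _ (hτ n)
  have heq : ∀ x : ℕ∞, MeasurableSet {ω | τ ω = x} := by
    intro x
    induction x with
    | top =>
      have h : {ω | τ ω = ⊤} = ⋂ n : ℕ, {ω | τ ω ≤ n}ᶜ := by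
        ext ω
        simp only [Set.mem_ofPred_eq, Set.mem_iInter, Set.mem_compl_iff]
        refine ⟨fun h n => by simp [h], fun h => ?_⟩
        by_contra hne
        obtain ⟨n, hn⟩ := ENat.ne_top_iff_exists.1 hne
        exact h n hn.ge
      rw [h]
      exact MeasurableSet.iInter fun n => (hle n).compl
    | coe n => exact (obsFiltration S).le n _ (measurableSet_eq_natCast hτ n)
  intro A _
  have h : (fun ω => F (τ ω)) ⁻¹' A = ⋃ x ∈ F ⁻¹' A, {ω | τ ω = x} := by
    ext ω
    simp
  rw [h]
  exact MeasurableSet.biUnion (Set.to_countable _) fun x _ => heq x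

theorem measurableSet_natCast_lt {τ : (ℕ → S) → ℕ∞} (hτ : IsStoppingTime (obsFiltration S) τ)
    (n : ℕ) : MeasurableSet {ω | (n : ℕ∞) < τ ω} := by
  have h : {ω | (n : ℕ∞) < τ ω} = {ω | τ ω ≤ n}ᶜ := by
    ext ω
    simp
  rw [h]
  exact ((obsFiltration S).le n _ (hτ n)).compl

/-- The part of the `G`-moment which is due to times after `N`. -/
noncomputable def gTail (G : ℝ → ℝ) (ν : Measure (ℕ → S)) (N : ℕ) (τ : (ℕ → S) → ℕ∞) : ℝ≥0∞ :=
  ∫⁻ ω, Set.indicator {x : ℕ∞ | (N : ℕ∞) < x} (extend G) (τ ω) ∂ν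

theorem IsModerate.gTail_le_tsum {G : ℝ → ℝ} (hG : IsModerate G) (ν : Measure (ℕ → S)) (N : ℕ)
    {τ : (ℕ → S) → ℕ∞} (hτ : IsStoppingTime (obsFiltration S) τ) :
    gTail G ν N τ ≤ ∑' n : ℕ, ENNReal.ofReal (G ((n + N : ℕ) + 1)) *
      ν {ω | ((n + N : ℕ) : ℕ∞) < τ ω} := by
  refine (lintegral_mono fun ω => hG.indicator_extend_le_tsum N (τ ω)).trans (le_of_eq ?_)
  rw [lintegral_tsum fun n => (measurable_comp_isStoppingTime hτ fun x =>
    ENNReal.ofReal (G ((n + N : ℕ) + 1)) *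
      Set.indicator {x : ℕ∞ | ((n + N : ℕ) : ℕ∞) < x} 1 x).aemeasurable]
  refine tsum_congr fun n => ?_
  rw [lintegral_const_mul _ (measurable_comp_isStoppingTime hτ fun x =>
    Set.indicator {x : ℕ∞ | ((n + N : ℕ) : ℕ∞) < x} 1 x)]
  congr 1
  rw [← lintegral_indicator_one (measurableSet_natCast_lt hτ (n + N))]
  rfl

theorem IsModerate.gMoment_le_add_gTail {G : ℝ → ℝ} (hG : IsModerate G) (ν : Measure (ℕ → S))
    [IsProbabilityMeasure ν] (N : ℕ) (τ : (ℕ → S) → ℕ∞) :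
    gMoment G ν τ ≤ ENNReal.ofReal (G N) + gTail G ν N τ := by
  have h : ∫⁻ _, ENNReal.ofReal (G N) ∂ν = ENNReal.ofReal (G N) := by simp
  rw [← h, gTail, ← lintegral_add_left measurable_const]
  refine lintegral_mono fun ω => ?_
  by_cases hN : (N : ℕ∞) < τ ω
  · rw [Set.indicator_of_mem (show τ ω ∈ {x : ℕ∞ | (N : ℕ∞) < x} from hN)]
    exact le_add_self
  · exact (hG.extend_mono (not_lt.1 hN)).trans le_self_add

namespace IsWalkRatio

variable {Q P ν μ : Measure (ℕ → S)} {w : ℝ} {f : S → ℝ} [IsProbabilityMeasure ν]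

theorem affinity_pos (h : IsWalkRatio Q P ν μ w f) : 0 < affinity ν f :=
  mgf_pos h.integrable_exp_half

/-- For `n ≥ B * t` the Chernoff bound is of order `√c * ρ ^ n` with `ρ` the affinity. Half of the
decay, `√ρ ^ n ≤ exp (-t / 2)`, pays for `√c`; the other half is summable against `G`. `B` precedes
`ε`, since later `ε` is chosen after the time scale is fixed, and `t` is only an upper bound for
`log c`, so that one `N` serves several levels. -/
theorem eventually_gTail_rejectTime_le (h : IsWalkRatio Q P ν μ w f) {G : ℝ → ℝ}
    (hG : IsModerate G) :
    ∀ᶠ B : ℝ in atTop, ∀ ε > 0, ∀ᶠ t : ℝ in atTop, ∀ c : ℝ, 0 < c → Real.log c ≤ t →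
      ∀ N : ℕ, B * t ≤ N → gTail G ν N (rejectTime Q P μ c) ≤ ENNReal.ofReal ε := by
  have hρ0 := h.affinity_pos
  have hρ1 := h.affinity_lt_one
  set ρ := affinity ν f
  have hlogρ : 0 < -Real.log ρ := by
    have := Real.log_neg hρ0 hρ1
    linarith
  filter_upwards [eventually_ge_atTop (1 / -Real.log ρ)] with B hB ε hε
  have hB0 : 0 < B := lt_of_lt_of_le (by positivity) hB
  have hr1 : √ρ < 1 := by
    rw [Real.sqrt_lt' one_pos]
    simpa using hρ1
  have hsum : Summable fun n : ℕ => G (n + 1) * √ρ ^ n :=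
    hG.summable_mul_pow (Real.sqrt_nonneg _) hr1
  have htail : Tendsto (fun N : ℕ => (√w)⁻¹ * ∑' n : ℕ, G ((n + N : ℕ) + 1) * √ρ ^ (n + N)) atTop
      (𝓝 0) := by
    have := (tendsto_sum_nat_add fun n : ℕ => G (n + 1) * √ρ ^ n).const_mul (√w)⁻¹
    rwa [mul_zero] at this
  obtain ⟨N₀, hN₀⟩ := eventually_atTop.1 (htail.eventually (eventually_le_nhds hε))
  have hBt : Tendsto (fun t : ℝ => B * t) atTop atTop := tendsto_id.const_mul_atTop hB0
  filter_upwards [hBt.eventually_ge_atTop N₀, hBt.eventually_ge_atTop 1, eventually_ge_atTop 0]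
    with t ht1 ht2 ht0 c hc hct N hN
  have hNN₀ : N₀ ≤ N := by exact_mod_cast ht1.trans hN
  have hN1 : 1 ≤ N := by exact_mod_cast ht2.trans hN
  refine (hG.gTail_le_tsum ν N (isStoppingTime_rejectTime Q P μ c)).trans ?_
  have hterm : ∀ n : ℕ, ENNReal.ofReal (G ((n + N : ℕ) + 1)) *
      ν {ω | ((n + N : ℕ) : ℕ∞) < rejectTime Q P μ c ω} ≤
      ENNReal.ofReal ((√w)⁻¹ * (G ((n + N : ℕ) + 1) * √ρ ^ (n + N))) := by
    intro n
    have h1 := h.measureReal_natCast_lt_rejectTime_le hc (n := n + N) (by omega)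
    have h2 : Real.exp (Real.log (c / w) / 2) * ρ ^ (n + N) ≤ (√w)⁻¹ * √ρ ^ (n + N) := by
      have h3 : ρ ^ (n + N) = √ρ ^ (n + N) * √ρ ^ (n + N) := by
        rw [← mul_pow, Real.mul_self_sqrt hρ0.le]
      have h4 : Real.exp (Real.log c / 2) * √ρ ^ (n + N) ≤ 1 := by
        rw [← Real.rpow_natCast, Real.rpow_def_of_pos (Real.sqrt_pos.2 hρ0), ← Real.exp_add,
          Real.exp_le_one_iff, Real.log_sqrt hρ0.le]
        have h5 : (N : ℝ) ≤ ((n + N : ℕ) : ℝ) := by push_cast; linarith [n.cast_nonneg (α := ℝ)]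
        have h6 : t ≤ -Real.log ρ * (B * t) := by
          have h7 : 1 ≤ -Real.log ρ * B := by
            rw [div_le_iff₀ hlogρ] at hB
            linarith
          nlinarith
        have h8 : -Real.log ρ * (B * t) ≤ -Real.log ρ * ((n + N : ℕ) : ℝ) :=
          mul_le_mul_of_nonneg_left (hN.trans h5) hlogρ.le
        linarith
      have h9 : Real.exp (Real.log (c / w) / 2) = (√w)⁻¹ * Real.exp (Real.log c / 2) := by
        rw [Real.log_div hc.ne' h.pos.ne', sub_div, Real.exp_sub, ← Real.log_sqrt h.pos.le,
          Real.exp_log (Real.sqrt_pos.2 h.pos), div_eq_mul_inv, mul_comm]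
      rw [h9, h3]
      calc (√w)⁻¹ * Real.exp (Real.log c / 2) * (√ρ ^ (n + N) * √ρ ^ (n + N))
          = (√w)⁻¹ * √ρ ^ (n + N) * (Real.exp (Real.log c / 2) * √ρ ^ (n + N)) := by ring
        _ ≤ (√w)⁻¹ * √ρ ^ (n + N) * 1 := mul_le_mul_of_nonneg_left h4 (by positivity)
        _ = _ := mul_one _
    have hGn : 0 ≤ G ((n + N : ℕ) + 1) := (hG.pos _ (by positivity)).le
    rw [← ENNReal.ofReal_toReal (measure_ne_top ν {ω | ((n + N : ℕ) : ℕ∞) < rejectTime Q P μ c ω}),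
      ← ENNReal.ofReal_mul hGn]
    refine ENNReal.ofReal_le_ofReal ?_
    refine (mul_le_mul_of_nonneg_left (h1.trans h2) hGn).trans (le_of_eq ?_)
    ring
  refine (ENNReal.tsum_le_tsum hterm).trans ?_
  rw [← ENNReal.ofReal_tsum_of_nonneg, tsum_mul_left]
  · exact ENNReal.ofReal_le_ofReal (hN₀ N hNN₀)
  · intro n
    have hGn : 0 ≤ G ((n + N : ℕ) + 1) := (hG.pos _ (by positivity)).le
    positivity
  · have := (summable_nat_add_iff N).2 hsum
    exact this.mul_left _

theorem gMoment_rejectTime_lt_top (h : IsWalkRatio Q P ν μ w f) {G : ℝ → ℝ}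
    (hG : IsModerate G) {c : ℝ} (hc : 0 < c) : gMoment G ν (rejectTime Q P μ c) < ⊤ := by
  obtain ⟨B, hB⟩ := (h.eventually_gTail_rejectTime_le hG).exists
  obtain ⟨t, ht, hct⟩ := ((hB 1 one_pos).and (eventually_ge_atTop (Real.log c))).exists
  refine (hG.gMoment_le_add_gTail ν ⌈B * t⌉₊ _).trans_lt ?_
  exact ENNReal.add_lt_top.2 ⟨ENNReal.ofReal_lt_top,
    (ht c hc hct _ (Nat.le_ceil _)).trans_lt ENNReal.ofReal_lt_top⟩

end IsWalkRatio

end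

/-! ### Comparison of `G`-moments and the asymptotic lower bound -/

section


variable {S ι : Type*} [MeasurableSpace S]

section Compare

variable {G : ℝ → ℝ} {ν : Measure (ℕ → S)}

theorem IsModerate.sum_ofReal_sub_le (hG : IsModerate G) (N : ℕ) :
    ∑ n ∈ Finset.range N, ENNReal.ofReal (G (n + 1 : ℕ) - G n) ≤ ENNReal.ofReal (G N) := by
  rw [← ENNReal.ofReal_sum_of_nonneg, Finset.sum_range_sub (fun n : ℕ => G n)]
  · refine ENNReal.ofReal_le_ofReal ?_
    have := hG.pos 0 le_rfl
    simp only [Nat.cast_zero]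
    linarith
  · intro n _
    rw [sub_nonneg]
    exact hG.mono (Set.mem_Ici.2 (by positivity)) (Set.mem_Ici.2 (by positivity))
      (by push_cast; linarith)

-- If `x > N`, the last term suffices; if `x ≤ N` and `y < x'`, then `G N` does. Otherwise `x' ≤ y`,
-- and `G x - G x'` is the sum of the increments of `G` over the `n` with `x' ≤ n < x`.
open Classical in
theorem IsModerate.extend_le_add (hG : IsModerate G) (N : ℕ) {x' x y : ℕ∞} (hx : x' ≤ x) :
    extend G x ≤ extend G y +
      (∑ n ∈ Finset.range N, ENNReal.ofReal (G (n + 1 : ℕ) - G n) *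
        (if x' ≤ n ∧ (n : ℕ∞) < x then 1 else 0) +
      (ENNReal.ofReal (G N) * (if y < x' then 1 else 0) +
        Set.indicator {x : ℕ∞ | (N : ℕ∞) < x} (extend G) x)) := by
  by_cases hN : (N : ℕ∞) < x
  · rw [Set.indicator_of_mem (show x ∈ {x : ℕ∞ | (N : ℕ∞) < x} from hN)]
    exact le_add_self.trans (le_add_self.trans le_add_self)
  · have hxN := not_lt.1 hN
    by_cases hy : y < x'
    · rw [if_pos hy, mul_one]
      exact (hG.extend_mono hxN).trans (le_self_add.trans (le_add_self.trans le_add_self))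
    · rw [not_lt] at hy
      obtain ⟨m, rfl⟩ := ENat.ne_top_iff_exists.1 (hxN.trans_lt (ENat.natCast_lt_top N)).ne
      obtain ⟨k, rfl⟩ := ENat.ne_top_iff_exists.1 (hx.trans_lt (ENat.natCast_lt_top m)).ne
      have hkm : k ≤ m := by exact_mod_cast hx
      have hmN : m ≤ N := by exact_mod_cast hxN
      rw [← add_assoc]
      refine le_trans ?_ le_self_add
      refine le_trans ?_ (add_le_add_left (hG.extend_mono hy) _)
      have hsub : ∑ n ∈ Finset.Ico k m, ENNReal.ofReal (G (n + 1 : ℕ) - G n) ≤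
          ∑ n ∈ Finset.range N, ENNReal.ofReal (G (n + 1 : ℕ) - G n) *
            (if (k : ℕ∞) ≤ n ∧ (n : ℕ∞) < m then 1 else 0) := by
        refine le_trans (Finset.sum_le_sum fun n hn => ?_)
          (Finset.sum_le_sum_of_subset (s := Finset.Ico k m) fun n hn => ?_)
        · rw [Finset.mem_Ico] at hn
          rw [if_pos ⟨by exact_mod_cast hn.1, by exact_mod_cast hn.2⟩, mul_one]
        · rw [Finset.mem_Ico] at hn
          exact Finset.mem_range.2 (hn.2.trans_le hmN)
      refine le_trans ?_ (add_le_add_right hsub _)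
      rw [extend_natCast, extend_natCast, ← ENNReal.ofReal_sum_of_nonneg,
        Finset.sum_Ico_sub (fun n : ℕ => G n) hkm, ← ENNReal.ofReal_add]
      · exact ENNReal.ofReal_le_ofReal (by linarith)
      · exact (hG.pos _ (by positivity)).le
      · rw [sub_nonneg]
        exact hG.mono (Set.mem_Ici.2 (by positivity)) (Set.mem_Ici.2 (by positivity))
          (by exact_mod_cast hkm)
      · intro n _
        rw [sub_nonneg]
        exact hG.mono (Set.mem_Ici.2 (by positivity)) (Set.mem_Ici.2 (by positivity))
          (by push_cast; linarith)

theorem IsModerate.gMoment_le_add (hG : IsModerate G) (N : ℕ) {τ' τ σ : (ℕ → S) → ℕ∞}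
    (hτ' : IsStoppingTime (obsFiltration S) τ') (hτ : IsStoppingTime (obsFiltration S) τ)
    (hσ : IsStoppingTime (obsFiltration S) σ) (hle : ∀ ω, τ' ω ≤ τ ω) {η β : ℝ≥0∞}
    (hη : ∀ n : ℕ, ν {ω | τ' ω ≤ n ∧ (n : ℕ∞) < τ ω} ≤ η) (hβ : ν {ω | σ ω < τ' ω} ≤ β) :
    gMoment G ν τ ≤ gMoment G ν σ + (ENNReal.ofReal (G N) * (η + β) + gTail G ν N τ) := by
  classical
  have hm1 : ∀ n : ℕ, MeasurableSet {ω | τ' ω ≤ n ∧ (n : ℕ∞) < τ ω} := fun n =>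
    ((obsFiltration S).le n _ (hτ' n)).inter (measurableSet_natCast_lt hτ n)
  have hm2 : MeasurableSet {ω | σ ω < τ' ω} := by
    have h : {ω | σ ω < τ' ω} = ⋃ n : ℕ, {ω | σ ω = n} ∩ {ω | (n : ℕ∞) < τ' ω} := by
      ext ω
      simp only [Set.mem_ofPred_eq, Set.mem_iUnion, Set.mem_inter_iff]
      constructor
      · intro h
        obtain ⟨n, hn⟩ := ENat.ne_top_iff_exists.1 (h.trans_le le_top).ne
        exact ⟨n, hn.symm, hn ▸ h⟩
      · rintro ⟨n, h1, h2⟩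
        exact h1 ▸ h2
    rw [h]
    exact MeasurableSet.iUnion fun n => ((obsFiltration S).le n _
      (measurableSet_eq_natCast hσ n)).inter (measurableSet_natCast_lt hτ' n)
  have hi1 : ∀ n : ℕ, Measurable fun ω => ENNReal.ofReal (G (n + 1 : ℕ) - G n) *
      (if τ' ω ≤ n ∧ (n : ℕ∞) < τ ω then 1 else 0) := fun n =>
    (Measurable.ite (hm1 n) measurable_const measurable_const).const_mul _
  have hi2 : Measurable fun ω => ENNReal.ofReal (G N) * (if σ ω < τ' ω then 1 else 0) :=
    (Measurable.ite hm2 measurable_const measurable_const).const_mul _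
  refine (lintegral_mono fun ω => hG.extend_le_add N (y := σ ω) (hle ω)).trans ?_
  rw [lintegral_add_left (measurable_comp_isStoppingTime hσ (extend G)),
    lintegral_add_left (Finset.measurable_sum _ fun n _ => hi1 n), lintegral_add_left hi2,
    lintegral_finsetSum _ fun n _ => hi1 n]
  refine add_le_add_right ?_ _
  rw [← add_assoc]
  refine add_le_add_left ?_ _
  rw [mul_add]
  refine add_le_add ?_ ?_
  · calc _ ≤ ∑ n ∈ Finset.range N, ENNReal.ofReal (G (n + 1 : ℕ) - G n) * η := by
          refine Finset.sum_le_sum fun n _ => ?_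
          rw [lintegral_const_mul _ (Measurable.ite (hm1 n) measurable_const measurable_const)]
          refine mul_le_mul_right (le_trans (le_of_eq ?_) (hη n)) _
          rw [← lintegral_indicator_one (hm1 n)]
          simp only [Set.indicator_apply, Set.mem_ofPred_eq, Pi.one_apply]
      _ ≤ _ := by
          rw [← Finset.sum_mul]
          exact mul_le_mul_left (hG.sum_ofReal_sub_le N) _
  · rw [lintegral_const_mul _ (Measurable.ite hm2 measurable_const measurable_const)]
    refine mul_le_mul_right (le_trans (le_of_eq ?_) hβ) _
    rw [← lintegral_indicator_one hm2]
    simp only [Set.indicator_apply, Set.mem_ofPred_eq, Pi.one_apply]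

theorem IsModerate.ofReal_mul_measure_lt_le_gMoment (hG : IsModerate G) (n : ℕ)
    {τ : (ℕ → S) → ℕ∞} (hτ : IsStoppingTime (obsFiltration S) τ) :
    ENNReal.ofReal (G n) * ν {ω | (n : ℕ∞) < τ ω} ≤ gMoment G ν τ := by
  rw [← setLIntegral_const]
  refine le_trans (setLIntegral_mono' (measurableSet_natCast_lt hτ n)
    fun ω (hω : (n : ℕ∞) < τ ω) => ?_) (setLIntegral_le_lintegral _ _)
  rw [← extend_natCast]
  exact hG.extend_mono hω.le

theorem IsModerate.ofReal_le_gMoment [IsProbabilityMeasure ν] (hG : IsModerate G)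
    (τ : (ℕ → S) → ℕ∞) : ENNReal.ofReal (G 0) ≤ gMoment G ν τ := by
  have h : ∫⁻ _, ENNReal.ofReal (G 0) ∂ν = ENNReal.ofReal (G 0) := by simp
  rw [← h]
  refine lintegral_mono fun ω => ?_
  have := hG.extend_mono (zero_le (a := τ ω))
  rwa [← Nat.cast_zero, extend_natCast, Nat.cast_zero] at this

end Compare

theorem exists_waldTime_le_rejectTime [Fintype ι] [Nontrivial ι] (Q P : Measure (ℕ → S))
    (H : ι → Measure (ℕ → S)) (c : ι → ℝ) (i : ι) (ω : ℕ → S) :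
    ∃ j, j ≠ i ∧ waldTime Q P H c ω ≤ rejectTime Q P (H j) (c j) ω := by
  classical
  obtain ⟨k, hk⟩ := exists_ne i
  obtain ⟨j, hj, hmax⟩ := Finset.exists_max_image (Finset.univ.erase i)
    (fun j => rejectTime Q P (H j) (c j) ω) ⟨k, by simpa using hk⟩
  exact ⟨j, by simpa using hj, waldTime_le_iff.2 ⟨i, fun l hl => hmax l (by simpa using hl)⟩⟩

/-- Wald's test ends no later than the slowest rejection among the indices other than `i`. The
choice of `i` is free: one spares `H i = ν`, or else the hypothesis with the highest level. -/
theorem IsModerate.gTail_waldTime_le {G : ℝ → ℝ} (hG : IsModerate G) [Fintype ι] [Nontrivial ι]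
    [DecidableEq ι] (Q P ν : Measure (ℕ → S)) (H : ι → Measure (ℕ → S)) (c : ι → ℝ) (i : ι)
    (N : ℕ) :
    gTail G ν N (waldTime Q P H c) ≤
      ∑ j ∈ Finset.univ.erase i, gTail G ν N (rejectTime Q P (H j) (c j)) := by
  have hmeas : ∀ j, Measurable fun ω =>
      Set.indicator {x : ℕ∞ | (N : ℕ∞) < x} (extend G) (rejectTime Q P (H j) (c j) ω) := fun j =>
    measurable_comp_isStoppingTime (isStoppingTime_rejectTime Q P (H j) (c j)) _
  simp only [gTail]
  rw [← lintegral_finsetSum _ fun j _ => hmeas j]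
  refine lintegral_mono fun ω => ?_
  obtain ⟨j, hj, hle⟩ := exists_waldTime_le_rejectTime Q P H c i ω
  refine le_trans ?_ (Finset.single_le_sum (fun _ _ => zero_le)
    (Finset.mem_erase.2 ⟨hj, Finset.mem_univ j⟩))
  by_cases hN : (N : ℕ∞) < waldTime Q P H c ω
  · rw [Set.indicator_of_mem (show _ ∈ {x : ℕ∞ | (N : ℕ∞) < x} from hN),
      Set.indicator_of_mem (show _ ∈ {x : ℕ∞ | (N : ℕ∞) < x} from hN.trans_le hle)]
    exact hG.extend_mono hle
  · rw [Set.indicator_of_notMem (show _ ∉ {x : ℕ∞ | (N : ℕ∞) < x} from hN)]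
    exact zero_le

/-- An i.i.d. law `ν`, minorized by `P`, under which the likelihood ratios of `P` to all the
hypotheses `H j ≠ ν` are governed by random walks. -/
structure IsReferenceLaw (Q P ν : Measure (ℕ → S)) (H : ι → Measure (ℕ → S)) (w : ℝ) : Prop where
  pos : 0 < w
  smul_le : ENNReal.ofReal w • ν ≤ P
  injective : Function.Injective H
  locallyEquivalent : ∀ i, LocallyEquivalent P (H i)
  absolutelyContinuous : ∀ i n, restr (H i) n ≪ restr Q n
  regular : ∀ i, H i ≠ ν → ∃ f, IsWalkRatio Q P ν (H i) w f

namespace IsReferenceLaw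

variable {Q P ν : Measure (ℕ → S)} {H : ι → Measure (ℕ → S)} {w : ℝ}

/-- The level `c j` fixes the time scale, whatever the relative rates. All rejections except that of
`H i` happen within order `log (c j)`, so the test ends by then. It cannot end much earlier, for it
must reject `H i` or `H j`, and `H i` is either the law `ν` itself or has a level at least `c j`. -/
theorem exists_slowest_pair [Fintype ι] [Nontrivial ι] (h : IsReferenceLaw Q P ν H w)
    (c : ι → ℝ) :
    ∃ i j, j ≠ i ∧ (∀ l, l ≠ i → H l ≠ ν ∧ c l ≤ c j) ∧ (H i = ν ∨ c j ≤ c i) := by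
  classical
  obtain ⟨i, hi1, hi2⟩ : ∃ i, (∀ l, l ≠ i → H l ≠ ν) ∧ (H i = ν ∨ ∀ l, c l ≤ c i) := by
    by_cases hex : ∃ i, H i = ν
    · obtain ⟨i, hi⟩ := hex
      exact ⟨i, fun l hl h' => hl (h.injective (h'.trans hi.symm)), Or.inl hi⟩
    · push Not at hex
      obtain ⟨i, hi⟩ := Finite.exists_max c
      exact ⟨i, fun l _ => hex l, Or.inr hi⟩
  obtain ⟨k, hk⟩ := exists_ne i
  obtain ⟨j, hj, hmax⟩ := Finset.exists_max_image (Finset.univ.erase i) c ⟨k, by simpa using hk⟩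
  exact ⟨i, j, by simpa using hj, fun l hl => ⟨hi1 l hl, hmax l (by simpa using hl)⟩,
    hi2.imp_right fun h => h j⟩

theorem gMoment_waldTime_lt_top [IsProbabilityMeasure ν] [Fintype ι] [Nontrivial ι] (h : IsReferenceLaw Q P ν H w)
    {G : ℝ → ℝ} (hG : IsModerate G) {c : ι → ℝ} (hc : ∀ i, 0 < c i) :
    gMoment G ν (waldTime Q P H c) < ⊤ := by
  classical
  obtain ⟨i, j, -, hreg, -⟩ := h.exists_slowest_pair c
  refine (hG.gMoment_le_add_gTail ν 0 _).trans_lt (ENNReal.add_lt_top.2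
    ⟨ENNReal.ofReal_lt_top, (hG.gTail_waldTime_le Q P ν H c i 0).trans_lt ?_⟩)
  refine ENNReal.sum_lt_top.2 fun l hl => ?_
  obtain ⟨f, hf⟩ := h.regular l (hreg l (Finset.mem_erase.1 hl).1).1
  refine lt_of_le_of_lt (lintegral_mono fun ω => ?_) (hf.gMoment_rejectTime_lt_top hG (hc l))
  exact Set.indicator_le_self' (fun _ _ => zero_le) _

variable [IsProbabilityMeasure Q] [IsProbabilityMeasure P]

theorem measure_lt_waldTime_le [Fintype ι] [Nonempty ι] (h : IsReferenceLaw Q P ν H w)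
    [∀ i, IsProbabilityMeasure (H i)] {a c : ι → ℝ} (hc : ∀ i, 1 ≤ c i)
    {σ : (ℕ → S) → ℕ∞} (hσ : σ ∈ timeClass P H a) :
    ν {ω | σ ω < waldTime Q P H c ω} ≤ ENNReal.ofReal w⁻¹ * ∑ i, ENNReal.ofReal (c i * a i) := by
  have h1 := SequentialTest.measure_lt_waldTime_le (fun i n => (h.locallyEquivalent i n).1)
    h.absolutelyContinuous hc hσ
  have h2 := h.smul_le {ω | σ ω < waldTime Q P H c ω}
  rw [Measure.smul_apply, smul_eq_mul] at h2
  rw [ENNReal.ofReal_inv_of_pos h.pos, mul_comm, ← div_eq_mul_inv,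
    ENNReal.le_div_iff_mul_le (Or.inl (ENNReal.ofReal_pos.2 h.pos).ne')
      (Or.inl ENNReal.ofReal_ne_top), mul_comm]
  exact h2.trans h1

variable [IsProbabilityMeasure ν]

theorem measureReal_rejectTime_lt_top_le (h : IsReferenceLaw Q P ν H w) {i : ι} (hi : H i = ν)
    {c : ℝ} (hc : 0 < c) : ν.real {ω | rejectTime Q P (H i) c ω < ⊤} ≤ c⁻¹ := by
  have h1 := h.locallyEquivalent i
  have h2 := h.absolutelyContinuous i
  rw [hi] at h1 h2 ⊢
  exact ENNReal.toReal_le_of_le_ofReal (inv_pos.2 hc).le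
    (measure_rejectTime_lt_top_le (fun n => (h1 n).1) h2 hc)

theorem eventually_measureReal_rejectTime_le_and_lt_le (h : IsReferenceLaw Q P ν H w) (i : ι)
    (b : ℝ) {ε : ℝ} (hε : 0 < ε) :
    ∀ᶠ c : ℝ in atTop, ∀ n : ℕ,
      ν.real {ω | rejectTime Q P (H i) (Real.exp (-b) * c) ω ≤ n ∧
        (n : ℕ∞) < rejectTime Q P (H i) c ω} ≤ ε := by
  by_cases hi : H i = ν
  · have hscale : Tendsto (fun c : ℝ => Real.exp (-b) * c) atTop atTop :=
      tendsto_id.const_mul_atTop (Real.exp_pos _)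
    filter_upwards [(tendsto_inv_atTop_zero.comp hscale).eventually (eventually_le_nhds hε),
      hscale.eventually_gt_atTop 0] with c hc1 hc2 n
    refine le_trans (measureReal_mono ?_) ((h.measureReal_rejectTime_lt_top_le hi hc2).trans hc1)
    rintro ω ⟨h1, -⟩
    exact h1.trans_lt (ENat.natCast_lt_top n)
  · obtain ⟨f, hf⟩ := h.regular i hi
    exact eventually_atTop.2 (hf.exists_measureReal_rejectTime_le_and_lt_le b hε)

/-- For `H i = ν` rejection at any time is unlikely by Ville, so no bound on `n` is needed;
otherwise Markov's inequality excludes rejection before a small multiple of `log c`. -/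
theorem eventually_measureReal_rejectTime_le_natCast_le (h : IsReferenceLaw Q P ν H w) (i : ι) :
    ∀ᶠ δ : ℝ in 𝓝[>] 0, ∀ᶠ c : ℝ in atTop, ∀ n : ℕ, H i = ν ∨ n ≤ δ * Real.log c →
      ν.real {ω | rejectTime Q P (H i) c ω ≤ n} ≤ 1 / 4 := by
  by_cases hi : H i = ν
  · refine Eventually.of_forall fun δ => ?_
    filter_upwards [eventually_ge_atTop 4] with c hc n _
    have hc0 : 0 < c := by linarith
    refine le_trans (measureReal_mono ?_) ((h.measureReal_rejectTime_lt_top_le hi hc0).trans ?_)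
    · intro ω (hω : rejectTime Q P (H i) c ω ≤ n)
      exact hω.trans_lt (ENat.natCast_lt_top n)
    · rw [inv_le_comm₀ hc0 (by norm_num)]
      linarith
  · obtain ⟨f, hf⟩ := h.regular i hi
    have t1 : Tendsto (fun δ : ℝ => 2 * δ * ∫ ω, |f (ω 0)| ∂ν) (𝓝[>] 0) (𝓝 0) := by
      have h1 : Continuous fun δ : ℝ => 2 * δ * ∫ ω, |f (ω 0)| ∂ν := by fun_prop
      have h2 := h1.tendsto 0
      simp only [mul_zero, zero_mul] at h2
      exact h2.mono_left nhdsWithin_le_nhds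
    have t2 : Tendsto (fun c : ℝ => (√c)⁻¹) atTop (𝓝 0) :=
      tendsto_inv_atTop_zero.comp Real.tendsto_sqrt_atTop
    filter_upwards [t1.eventually (eventually_le_nhds (show (0 : ℝ) < 1 / 8 by norm_num))]
      with δ hδ
    filter_upwards [t2.eventually (eventually_le_nhds (show (0 : ℝ) < 1 / 8 by norm_num)),
      eventually_gt_atTop 1] with c hc hc1 n hn
    have hn := hn.resolve_left hi
    have hlog := Real.log_pos hc1
    have h1 := hf.measureReal_rejectTime_le_natCast_le hc1 n
    have h2 : 2 * n * (∫ ω, |f (ω 0)| ∂ν) / Real.log c ≤ 1 / 8 := by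
      rw [div_le_iff₀ hlog]
      have h3 : 0 ≤ ∫ ω, |f (ω 0)| ∂ν := integral_nonneg fun ω => abs_nonneg _
      calc 2 * n * (∫ ω, |f (ω 0)| ∂ν) = 2 * (∫ ω, |f (ω 0)| ∂ν) * n := by ring
        _ ≤ 2 * (∫ ω, |f (ω 0)| ∂ν) * (δ * Real.log c) :=
            mul_le_mul_of_nonneg_left hn (by positivity)
        _ = 2 * δ * (∫ ω, |f (ω 0)| ∂ν) * Real.log c := by ring
        _ ≤ 1 / 8 * Real.log c := mul_le_mul_of_nonneg_right hδ hlog.le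
    linarith

/-- The `G`-moment of Wald's observation time at the level `c = 1 / a` is asymptotically not larger
than that of any observation time in `timeClass P H a`. -/
theorem eventually_gMoment_waldTime_le [Fintype ι] [Nontrivial ι] (h : IsReferenceLaw Q P ν H w)
    [∀ i, IsProbabilityMeasure (H i)] {G : ℝ → ℝ} (hG : IsModerate G) {e : ℝ} (he : 0 < e) :
    ∃ c₀ : ℝ, ∀ c : ι → ℝ, (∀ i, c₀ ≤ c i) → ∀ σ ∈ timeClass P H fun i => (c i)⁻¹,
      gMoment G ν (waldTime Q P H c) ≤
        gMoment G ν σ + ENNReal.ofReal e * gMoment G ν (waldTime Q P H c) := by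
  classical
  have hcard : 0 < (Fintype.card ι : ℝ) := by exact_mod_cast Fintype.card_pos
  have hG0 := hG.pos 0 le_rfl
  have hw := h.pos
  obtain ⟨δ, hδ, hδ0⟩ : ∃ δ : ℝ, (∀ i, ∀ᶠ c : ℝ in atTop, ∀ n : ℕ, H i = ν ∨ n ≤ δ * Real.log c →
      ν.real {ω | rejectTime Q P (H i) c ω ≤ n} ≤ 1 / 4) ∧ 0 < δ :=
    ((eventually_all.2 h.eventually_measureReal_rejectTime_le_natCast_le).and
      self_mem_nhdsWithin).exists
  obtain ⟨B, hB, hB0⟩ : ∃ B : ℝ, (∀ i, H i ≠ ν → ∀ ε > 0, ∀ᶠ t : ℝ in atTop, ∀ c : ℝ, 0 < c →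
      Real.log c ≤ t → ∀ N : ℕ, B * t ≤ N →
      gTail G ν N (rejectTime Q P (H i) c) ≤ ENNReal.ofReal ε) ∧ 0 < B := by
    refine ((eventually_all.2 fun i => ?_).and (eventually_gt_atTop 0)).exists
    by_cases hi : H i = ν
    · exact Eventually.of_forall fun B hne => absurd hi hne
    · obtain ⟨f, hf⟩ := h.regular i hi
      filter_upwards [hf.eventually_gTail_rejectTime_le hG] with B hB _ using hB
  obtain ⟨C, hC1, hC⟩ := hG.exists_le_pow_mul
  -- `m` doublings lead from `n`, about `δ * t`, beyond `N`, about `B * t`. The factor 2 absorbs the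
  -- rounding, and the 2 in `K` the probability 1/2 in `hhalf`.
  obtain ⟨m, hm⟩ := pow_unbounded_of_one_lt (2 * (B + δ) / δ) one_lt_two
  set K := 2 * C ^ m
  have hK : 0 < K := by positivity
  obtain ⟨b, hb, hb0⟩ : ∃ b : ℝ,
      w⁻¹ * (Fintype.card ι * Real.exp (-b)) ≤ e / (4 * K) ∧ 0 ≤ b := by
    have t1 : Tendsto (fun b : ℝ => w⁻¹ * (Fintype.card ι * Real.exp (-b))) atTop (𝓝 0) := by
      simpa using (Real.tendsto_exp_neg_atTop_nhds_zero.const_mul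
        (Fintype.card ι : ℝ)).const_mul w⁻¹
    exact ((t1.eventually (eventually_le_nhds (by positivity))).and (eventually_ge_atTop 0)).exists
  -- The total error `e` is split as `e / 4` for the change of level, `e / 4` for early stopping of
  -- `σ`, and `e / 2` for times after `N`.
  set ε₁ := e / (4 * K * Fintype.card ι) with hε₁_def
  set ε₂ := e * G 0 / (2 * Fintype.card ι) with hε₂_def
  have hε₁ : 0 < ε₁ := by positivity
  have hε₂ : 0 < ε₂ := by positivity
  have hlevel : ∀ᶠ c : ℝ in atTop, 1 < c ∧ 1 ≤ Real.exp (-b) * c ∧ 1 ≤ δ * Real.log c := by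
    filter_upwards [eventually_gt_atTop 1, (tendsto_id.const_mul_atTop
      (Real.exp_pos (-b))).eventually_ge_atTop 1,
      (Real.tendsto_log_atTop.const_mul_atTop hδ0).eventually_ge_atTop 1] with c h1 h2 h3
    exact ⟨h1, h2, h3⟩
  have htail : ∀ᶠ t : ℝ in atTop, ∀ i, H i ≠ ν → ∀ c : ℝ, 0 < c → Real.log c ≤ t →
      ∀ N : ℕ, B * t ≤ N → gTail G ν N (rejectTime Q P (H i) c) ≤ ENNReal.ofReal ε₂ := by
    refine eventually_all.2 fun i => ?_
    by_cases hi : H i = ν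
    · exact Eventually.of_forall fun t hne => absurd hi hne
    · filter_upwards [hB i hi ε₂ hε₂] with t ht _ using ht
  obtain ⟨c₀, hc₀⟩ := eventually_atTop.1 ((hlevel.and (Real.tendsto_log_atTop.eventually htail)).and
    (eventually_all.2 fun i => (hδ i).and
      (h.eventually_measureReal_rejectTime_le_and_lt_le i b hε₁)))
  refine ⟨c₀, fun c hc σ hσ => ?_⟩
  have hc1 : ∀ i, 1 < c i := fun i => (hc₀ (c i) (hc i)).1.1.1
  have hcpos : ∀ i, 0 < c i := fun i => zero_lt_one.trans (hc1 i)
  have hcb : ∀ i, 1 ≤ Real.exp (-b) * c i := fun i => (hc₀ (c i) (hc i)).1.1.2.1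
  obtain ⟨i, j, hji, hreg, hij⟩ := h.exists_slowest_pair c
  have hst := isStoppingTime_waldTime Q P H c
  have hst' := isStoppingTime_waldTime Q P H fun i => Real.exp (-b) * c i
  set τ := waldTime Q P H c
  set t := Real.log (c j) with ht
  have hδt : 1 ≤ δ * t := (hc₀ (c j) (hc j)).1.1.2.2
  have htpos : 0 < t := Real.log_pos (hc1 j)
  set n := ⌊δ * t⌋₊
  set N := ⌈B * t⌉₊
  have hn : (n : ℝ) ≤ δ * t := Nat.floor_le (by positivity)
  have hhalf : ENNReal.ofReal (1 / 2) ≤ ν {ω | (n : ℕ∞) < τ ω} := by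
    have h1 : ν.real {ω | rejectTime Q P (H i) (c i) ω ≤ n} ≤ 1 / 4 := by
      refine ((hc₀ (c i) (hc i)).2 i).1 n (hij.imp_right fun hle => hn.trans ?_)
      exact mul_le_mul_of_nonneg_left (Real.log_le_log (hcpos j) hle) hδ0.le
    have h2 : ν.real {ω | rejectTime Q P (H j) (c j) ω ≤ n} ≤ 1 / 4 :=
      ((hc₀ (c j) (hc j)).2 j).1 n (Or.inr hn)
    -- Wald's test spares only one index, so stopping requires the rejection of `H i` or `H j`.
    have h3 : {ω | (n : ℕ∞) < τ ω}ᶜ ⊆ {ω | rejectTime Q P (H i) (c i) ω ≤ n} ∪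
        {ω | rejectTime Q P (H j) (c j) ω ≤ n} := by
      intro ω hω
      rw [Set.mem_compl_iff, Set.mem_ofPred_eq, not_lt] at hω
      obtain ⟨l, hl⟩ := waldTime_le_iff.1 hω
      by_cases hil : i = l
      · exact Or.inr (hl j (hil ▸ hji))
      · exact Or.inl (hl i hil)
    have h4 := (measureReal_mono h3).trans (measureReal_union_le (μ := ν) _ _)
    rw [probReal_compl_eq_one_sub (measurableSet_natCast_lt hst n)] at h4
    rw [← ENNReal.ofReal_toReal (measure_ne_top ν {ω | (n : ℕ∞) < τ ω})]
    refine ENNReal.ofReal_le_ofReal ?_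
    change 1 / 2 ≤ ν.real {ω | (n : ℕ∞) < τ ω}
    linarith
  have hGN : ENNReal.ofReal (G N) ≤ ENNReal.ofReal K * gMoment G ν τ := by
    have h1 : (N : ℝ) ≤ 2 ^ m * n := by
      have h2 : (N : ℝ) < B * t + 1 := Nat.ceil_lt_add_one (by positivity)
      have h3 : δ * t < n + 1 := Nat.lt_floor_add_one _
      have h4 : (1 : ℝ) ≤ n := by exact_mod_cast (Nat.one_le_floor_iff _).2 hδt
      have h5 : δ * t / 2 ≤ n := by linarith
      calc (N : ℝ) ≤ (B + δ) * t := by linarith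
        _ = 2 * (B + δ) / δ * (δ * t / 2) := by field_simp
        _ ≤ 2 ^ m * n := mul_le_mul hm.le h5 (by positivity) (by positivity)
    have h2 : G N ≤ K * (G n * (1 / 2)) := by
      refine (hG.mono (Set.mem_Ici.2 (by positivity)) (Set.mem_Ici.2 (by positivity)) h1).trans
        ((hC m n (by positivity)).trans (le_of_eq ?_))
      ring
    refine (ENNReal.ofReal_le_ofReal h2).trans ?_
    rw [ENNReal.ofReal_mul hK.le, ENNReal.ofReal_mul (hG.pos n (by positivity)).le]
    refine mul_le_mul_right ?_ _
    exact (mul_le_mul_right hhalf _).trans (hG.ofReal_mul_measure_lt_le_gMoment n hst)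
  have hη : ∀ k : ℕ, ν {ω | waldTime Q P H (fun i => Real.exp (-b) * c i) ω ≤ k ∧
      (k : ℕ∞) < τ ω} ≤ ENNReal.ofReal (e / (4 * K)) := by
    intro k
    have h1 : {ω | waldTime Q P H (fun i => Real.exp (-b) * c i) ω ≤ k ∧ (k : ℕ∞) < τ ω} ⊆
        ⋃ l, {ω | rejectTime Q P (H l) (Real.exp (-b) * c l) ω ≤ k ∧
          (k : ℕ∞) < rejectTime Q P (H l) (c l) ω} := by
      rintro ω ⟨h2, h3⟩
      obtain ⟨l, hl⟩ := waldTime_le_iff.1 h2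
      rw [← not_le, waldTime_le_iff] at h3
      push Not at h3
      obtain ⟨l', hne, hl'⟩ := h3 l
      exact Set.mem_iUnion.2 ⟨l', hl l' hne, hl'⟩
    refine (measure_mono h1).trans ((measure_iUnion_fintype_le _ _).trans ?_)
    have h2 : ∀ l, ν {ω | rejectTime Q P (H l) (Real.exp (-b) * c l) ω ≤ k ∧
          (k : ℕ∞) < rejectTime Q P (H l) (c l) ω} ≤ ENNReal.ofReal ε₁ := by
      intro l
      rw [← ENNReal.ofReal_toReal (measure_ne_top ν _)]
      exact ENNReal.ofReal_le_ofReal (((hc₀ (c l) (hc l)).2 l).2 k)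
    refine (Finset.sum_le_sum fun l _ => h2 l).trans (le_of_eq ?_)
    rw [Finset.sum_const, Finset.card_univ, nsmul_eq_mul, ← ENNReal.ofReal_natCast,
      ← ENNReal.ofReal_mul hcard.le]
    congr 1
    rw [hε₁_def]
    field_simp
  have hβ : ν {ω | σ ω < waldTime Q P H (fun i => Real.exp (-b) * c i) ω} ≤
      ENNReal.ofReal (e / (4 * K)) := by
    refine (h.measure_lt_waldTime_le hcb hσ).trans ?_
    -- With `a = 1 / c` the bound on early stopping depends on `b` only.
    have h1 : ∀ l, Real.exp (-b) * c l * (c l)⁻¹ = Real.exp (-b) := fun l =>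
      mul_inv_cancel_right₀ (hcpos l).ne' _
    simp_rw [h1]
    rw [Finset.sum_const, Finset.card_univ, nsmul_eq_mul, ← ENNReal.ofReal_natCast,
      ← ENNReal.ofReal_mul hcard.le, ← ENNReal.ofReal_mul (inv_pos.2 hw).le]
    exact ENNReal.ofReal_le_ofReal hb
  have hrest : gTail G ν N τ ≤ ENNReal.ofReal (e / 2) * gMoment G ν τ := by
    refine (hG.gTail_waldTime_le Q P ν H c i N).trans ?_
    have h1 : ∀ l ∈ Finset.univ.erase i, gTail G ν N (rejectTime Q P (H l) (c l)) ≤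
        ENNReal.ofReal ε₂ := by
      intro l hl
      obtain ⟨h2, h3⟩ := hreg l (Finset.mem_erase.1 hl).1
      exact (hc₀ (c j) (hc j)).1.2 l h2 (c l) (hcpos l) (Real.log_le_log (hcpos l) h3) N
        (Nat.le_ceil _)
    refine (Finset.sum_le_sum h1).trans ((Finset.sum_le_sum_of_subset
      (Finset.erase_subset _ _)).trans ?_)
    refine le_trans (le_of_eq ?_) (mul_le_mul_right (hG.ofReal_le_gMoment τ) _)
    rw [Finset.sum_const, Finset.card_univ, nsmul_eq_mul, ← ENNReal.ofReal_natCast,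
      ← ENNReal.ofReal_mul hcard.le, ← ENNReal.ofReal_mul (by positivity)]
    congr 1
    rw [hε₂_def]
    field_simp
  have hmain := hG.gMoment_le_add N hst' hst hσ.choose_spec.1.choose (fun ω => waldTime_mono
    fun l => mul_le_of_le_one_left (hcpos l).le (Real.exp_le_one_iff.2 (by linarith))) hη hβ
  refine hmain.trans (add_le_add_right ?_ _)
  calc ENNReal.ofReal (G N) * (ENNReal.ofReal (e / (4 * K)) + ENNReal.ofReal (e / (4 * K))) +
        gTail G ν N τ
      ≤ ENNReal.ofReal K * gMoment G ν τ * ENNReal.ofReal (e / (2 * K)) +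
        ENNReal.ofReal (e / 2) * gMoment G ν τ := by
        refine add_le_add ?_ hrest
        rw [← ENNReal.ofReal_add (by positivity) (by positivity)]
        refine mul_le_mul' hGN (ENNReal.ofReal_le_ofReal (le_of_eq ?_))
        field_simp
        norm_num
    _ = ENNReal.ofReal e * gMoment G ν τ := by
        rw [mul_right_comm, ← ENNReal.ofReal_mul hK.le, ← add_mul,
          ← ENNReal.ofReal_add (by positivity) (by positivity)]
        congr 2
        field_simp
        norm_num

end IsReferenceLaw

end

/-! ### Construction of reference laws and passage to the ratio of moments -/

section

variable {S ι : Type*} [MeasurableSpace S]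

theorem ae_le_likelihoodRatio {Q P ν : Measure (ℕ → S)} [IsProbabilityMeasure Q]
    [IsProbabilityMeasure P] [IsProbabilityMeasure ν] {w : ℝ}
    (hw : ENNReal.ofReal w • ν ≤ P) (n : ℕ) (hPν : restr P n ≪ restr ν n)
    (hνQ : restr ν n ≪ restr Q n) : ∀ᵐ ω ∂ν, w ≤ likelihoodRatio Q P ν n ω := by
  have hm : Measurable[obsFiltration S n] fun ω => ENNReal.ofReal (likelihoodRatio Q P ν n ω) :=
    (measurable_likelihoodRatio Q P ν n).ennreal_ofReal
  have hmc : Measurable[obsFiltration S n] fun _ : ℕ → S => ENNReal.ofReal w := measurable_const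
  have h : (fun _ => ENNReal.ofReal w) ≤ᵐ[restr ν n]
      fun ω => ENNReal.ofReal (likelihoodRatio Q P ν n ω) := by
    refine ae_le_of_forall_setLIntegral_le_of_sigmaFinite hmc fun A hA _ => ?_
    rw [restr, setLIntegral_trim _ hm hA, setLIntegral_trim _ hmc hA,
      setLIntegral_likelihoodRatio Q P ν n hPν hνQ hA, setLIntegral_const]
    exact hw A
  filter_upwards [ae_of_ae_trim _ h] with ω hω
  exact (ENNReal.ofReal_le_ofReal_iff (likelihoodRatio_nonneg _ _ _ _ _)).1 hω

theorem IsModerate.integrable_of_abs_mul {Ω : Type*} [MeasurableSpace Ω] {P : Measure Ω}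
    {G : ℝ → ℝ} (hG : IsModerate G) {X : Ω → ℝ} (hX : Measurable X)
    (h : Integrable (fun ω => |X ω| * G |X ω|) P) : Integrable X P := by
  have hG0 := hG.pos 0 le_rfl
  refine (h.div_const (G 0)).mono' hX.aestronglyMeasurable (ae_of_all _ fun ω => ?_)
  rw [Real.norm_eq_abs, le_div_iff₀ hG0]
  exact mul_le_mul_of_nonneg_left (hG.mono (Set.mem_Ici.2 le_rfl)
    (Set.mem_Ici.2 (abs_nonneg _)) (abs_nonneg _)) (abs_nonneg _)

/-- An i.i.d. law which is minorized by `P` is a reference law. -/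
theorem isReferenceLaw {Q P ν : Measure (ℕ → S)} {H : ι → Measure (ℕ → S)} {w : ℝ} {G : ℝ → ℝ}
    [IsProbabilityMeasure Q] [IsProbabilityMeasure P] [IsProbabilityMeasure ν]
    [∀ i, IsProbabilityMeasure (H i)] (hG : IsModerate G)
    (hinj : Function.Injective H) (hiid : ∀ i, IsIIDLaw (H i)) (hQ : ∀ i, H i ≪ Q)
    (hP : ∀ i, LocallyEquivalent P (H i))
    (hint : ∀ i, Integrable (fun ω =>
      |Real.log (likelihoodRatio Q P (H i) 1 ω)| *
        G |Real.log (likelihoodRatio Q P (H i) 1 ω)|) P)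
    (hν : IsIIDLaw ν) (hPν : LocallyEquivalent P ν) (hw0 : 0 < w)
    (hw : ENNReal.ofReal w • ν ≤ P) : IsReferenceLaw Q P ν H w := by
  refine ⟨hw0, hw, hinj, hP, fun i => restr_absolutelyContinuous (hQ i), fun i hi => ?_⟩
  have hνH : LocallyEquivalent ν (H i) := hPν.symm.trans (hP i)
  have hHQ := restr_absolutelyContinuous (hQ i)
  have hνQ : ∀ n, restr ν n ≪ restr Q n := fun n => (hνH n).1.trans (hHQ n)
  obtain ⟨f, hf, hratio, hexp, hone, hnd⟩ := exists_logRatio hν (hiid i) hνH hHQ (Ne.symm hi)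
  have hfactor : ∀ᵐ ω ∂ν, ∀ n, w ≤ likelihoodRatio Q P ν n ω ∧
      likelihoodRatio Q P (H i) n ω =
        likelihoodRatio Q P ν n ω * Real.exp (∑ m ∈ Finset.range n, f (ω m)) := by
    have h1 := ae_all_iff.2 fun n => ae_le_likelihoodRatio hw n (hPν n).1 (hνQ n)
    have h2 := ae_all_iff.2 fun n => ae_density_pos Q ν n (hνQ n)
    filter_upwards [hratio, h1, h2] with ω h3 h4 h5 n
    refine ⟨h4 n, ?_⟩
    rw [← h3 n, likelihoodRatio, likelihoodRatio, likelihoodRatio,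
      div_mul_div_cancel₀ (h5 n).ne']
  refine ⟨f, hν, hPν, hνQ, hw0, hf, hfactor, hexp, hone, hnd, ?_⟩
  have hmeas : ∀ μ : Measure (ℕ → S), Measurable (likelihoodRatio Q P μ 1) := fun μ =>
    (measurable_likelihoodRatio Q P μ 1).mono ((obsFiltration S).le 1) le_rfl
  have hle : ν ≤ (ENNReal.ofReal w)⁻¹ • P := by
    intro A
    have h1 := hw A
    rw [Measure.smul_apply, smul_eq_mul] at h1 ⊢
    rw [mul_comm, ← div_eq_mul_inv, ENNReal.le_div_iff_mul_le
      (Or.inl (ENNReal.ofReal_pos.2 hw0).ne') (Or.inl ENNReal.ofReal_ne_top), mul_comm]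
    exact h1
  have hlog : Integrable (fun ω => Real.log (likelihoodRatio Q P (H i) 1 ω)) ν := by
    have h1 := hG.integrable_of_abs_mul (hmeas (H i)).log (hint i)
    exact (h1.smul_measure (ENNReal.inv_ne_top.2 (ENNReal.ofReal_pos.2 hw0).ne')).mono_measure hle
  have hΛ : Integrable (likelihoodRatio Q P ν 1) ν := by
    refine ⟨(hmeas ν).aestronglyMeasurable, ?_⟩
    rw [hasFiniteIntegral_iff_ofReal (ae_of_all _ fun ω => likelihoodRatio_nonneg _ _ _ _ _),
      ← setLIntegral_univ, setLIntegral_likelihoodRatio Q P ν 1 (hPν 1).1 (hνQ 1)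
        (@MeasurableSet.univ _ (obsFiltration S 1))]
    exact measure_lt_top _ _
  -- The step is `log R^i_1` minus the logarithm of the ratio of `P` to `ν`. The latter is bounded
  -- below by `log w` and above by the ratio itself, whose `ν`-integral is 1.
  have hlogΛ : Integrable (fun ω => Real.log (likelihoodRatio Q P ν 1 ω)) ν := by
    refine ((integrable_const |Real.log w|).add hΛ).mono' (hmeas ν).log.aestronglyMeasurable ?_
    filter_upwards [hfactor] with ω hω
    have h1 := (hω 1).1
    have h2 : 0 < likelihoodRatio Q P ν 1 ω := hw0.trans_le h1
    have h3 := Real.log_le_sub_one_of_pos h2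
    have h4 := Real.log_le_log hw0 h1
    rw [Real.norm_eq_abs, Pi.add_apply, abs_le]
    constructor
    · linarith [neg_abs_le (Real.log w)]
    · linarith [abs_nonneg (Real.log w)]
  refine (hlog.sub hlogΛ).congr ?_
  filter_upwards [hfactor] with ω hω
  have h1 : 0 < likelihoodRatio Q P ν 1 ω := hw0.trans_le (hω 1).1
  rw [Pi.sub_apply, (hω 1).2, Real.log_mul h1.ne' (Real.exp_pos _).ne', Real.log_exp,
    Finset.sum_range_one]
  ring

theorem toENNReal_le_extend_add_one (x : ℕ∞) : (x : ℝ≥0∞) ≤ extend (fun t => t + 1) x := by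
  induction x with
  | top => exact le_top
  | coe n =>
    rw [extend_natCast, ENat.toENNReal_coe, ← ENNReal.ofReal_natCast]
    exact ENNReal.ofReal_le_ofReal (by linarith)

theorem IsReferenceLaw.lintegral_waldTime_lt_top [Fintype ι] [Nontrivial ι]
    {Q P ν : Measure (ℕ → S)} {H : ι → Measure (ℕ → S)} {w : ℝ} [IsProbabilityMeasure ν]
    (h : IsReferenceLaw Q P ν H w) {c : ι → ℝ} (hc : ∀ i, 0 < c i) :
    ∫⁻ ω, (waldTime Q P H c ω : ℝ≥0∞) ∂ν < ⊤ :=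
  (lintegral_mono fun _ => toENNReal_le_extend_add_one _).trans_lt
    (h.gMoment_waldTime_lt_top IsModerate.add_one hc)

/-- Since `M` is finite and nonzero, the hypotheses squeeze `I / M` between `1 - e` and 1 in the
reals; inverting gives the claim. -/
theorem tendsto_ennreal_div_one {α : Type*} {l : Filter α} {M I : α → ℝ≥0∞}
    (hM : ∀ᶠ a in l, M a ≠ ⊤) (hM0 : ∀ᶠ a in l, M a ≠ 0) (hI : ∀ᶠ a in l, I a ≤ M a)
    (hle : ∀ e : ℝ, 0 < e → ∀ᶠ a in l, M a ≤ I a + ENNReal.ofReal e * M a) :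
    Tendsto (fun a => M a / I a) l (𝓝 1) := by
  have hreal : Tendsto (fun a => (I a).toReal / (M a).toReal) l (𝓝 1) := by
    rw [Metric.tendsto_nhds]
    intro e he
    filter_upwards [hM, hM0, hI, hle (e / 2) (by positivity)] with a h1 h2 h3 h4
    have hMpos : 0 < (M a).toReal := ENNReal.toReal_pos h2 h1
    have h5 : (I a).toReal ≤ (M a).toReal := ENNReal.toReal_mono h1 h3
    have hIt : I a ≠ ⊤ := (h3.trans_lt h1.lt_top).ne
    have h6 : (M a).toReal ≤ (I a).toReal + e / 2 * (M a).toReal := by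
      have h7 := ENNReal.toReal_mono (ENNReal.add_ne_top.2
        ⟨hIt, ENNReal.mul_ne_top ENNReal.ofReal_ne_top h1⟩) h4
      rwa [ENNReal.toReal_add hIt (ENNReal.mul_ne_top ENNReal.ofReal_ne_top h1),
        ENNReal.toReal_mul, ENNReal.toReal_ofReal (by positivity)] at h7
    rw [Real.dist_eq, abs_lt]
    constructor
    · have : 1 - e / 2 ≤ (I a).toReal / (M a).toReal := by
        rw [le_div_iff₀ hMpos]
        linarith
      linarith
    · have : (I a).toReal / (M a).toReal ≤ 1 := by
        rw [div_le_one hMpos]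
        exact h5
      linarith
  have h1 := (ENNReal.continuous_ofReal.tendsto 1).comp hreal
  have h2 := (tendsto_inv_iff.2 h1)
  rw [ENNReal.ofReal_one, inv_one] at h2
  refine h2.congr' ?_
  filter_upwards [hM, hM0, hI] with a h3 h4 h5
  have hMpos : 0 < (M a).toReal := ENNReal.toReal_pos h4 h3
  rw [Function.comp_apply, ENNReal.ofReal_div_of_pos hMpos, ENNReal.ofReal_toReal h3,
    ENNReal.ofReal_toReal (h5.trans_lt h3.lt_top).ne, ENNReal.inv_div (Or.inl h3) (Or.inl h4)]

/-- Wald's test at the level `1 / a` is asymptotically optimal under every reference law. -/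
theorem IsReferenceLaw.waldAsymptoticallyOptimal [Fintype ι] [Nontrivial ι]
    {Q P ν : Measure (ℕ → S)} {H : ι → Measure (ℕ → S)} {w : ℝ} {G : ℝ → ℝ}
    [IsProbabilityMeasure Q] [IsProbabilityMeasure P] [IsProbabilityMeasure ν]
    [∀ i, IsProbabilityMeasure (H i)] (h : IsReferenceLaw Q P ν H w) (hG : IsModerate G)
    {sel : Finset ι → ι} (hadm : WaldAdmissible sel Q P H fun a i => (a i)⁻¹) :
    WaldAsymptoticallyOptimal G Q P H (fun a i => (a i)⁻¹) ν := by
  have hpos : ∀ᶠ a : ι → ℝ in 𝓝[{a : ι → ℝ | ∀ i, 0 < a i}] 0, ∀ i, 0 < a i :=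
    self_mem_nhdsWithin
  refine tendsto_ennreal_div_one ?_ ?_ ?_ fun e he => ?_
  · filter_upwards [hpos] with a ha
    exact (h.gMoment_waldTime_lt_top hG fun i => inv_pos.2 (ha i)).ne
  · refine Eventually.of_forall fun a => ?_
    exact ((ENNReal.ofReal_pos.2 (hG.pos 0 le_rfl)).trans_le (hG.ofReal_le_gMoment _)).ne'
  · filter_upwards [hpos] with a ha
    exact iInf₂_le _ ⟨_, hadm a ha⟩
  · obtain ⟨c₀, hc₀⟩ := h.eventually_gMoment_waldTime_le hG he
    have hlarge : ∀ᶠ a : ι → ℝ in 𝓝[{a : ι → ℝ | ∀ i, 0 < a i}] 0, ∀ i, c₀ ≤ (a i)⁻¹ := by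
      refine eventually_all.2 fun i => ?_
      have h1 : Tendsto (fun a : ι → ℝ => a i) (𝓝[{a : ι → ℝ | ∀ i, 0 < a i}] 0) (𝓝[>] 0) := by
        refine tendsto_nhdsWithin_iff.2 ⟨?_, ?_⟩
        · exact ((continuous_apply i).tendsto 0).mono_left nhdsWithin_le_nhds
        · filter_upwards [hpos] with a ha using ha i
      exact (tendsto_inv_nhdsGT_zero.comp h1).eventually_ge_atTop c₀
    filter_upwards [hlarge] with a ha
    rw [ENNReal.iInf_add]
    refine le_iInf fun τ => ?_
    rw [ENNReal.iInf_add]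
    refine le_iInf fun hτ => ?_
    refine hc₀ _ ha τ ?_
    simpa only [inv_inv] using hτ

end

end SequentialTest

/-! ### The i.i.d. case and the mixture case -/

open SequentialTest in
theorem theorem2 {S ι : Type*} [MeasurableSpace S] [Fintype ι] [Nontrivial ι]
    (G : ℝ → ℝ) (hG : IsModerate G)
    (H : ι → Measure (ℕ → S)) [∀ i, IsProbabilityMeasure (H i)]
    (hdistinct : Function.Injective H) (hiid : ∀ i, IsIIDLaw (H i))
    (Q : Measure (ℕ → S)) [IsProbabilityMeasure Q] (hQ : ∀ i, H i ≪ Q)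
    (P : Measure (ℕ → S)) [IsProbabilityMeasure P] (hP : ∀ i, LocallyEquivalent P (H i))
    (hint : ∀ i, Integrable (fun ω =>
      |Real.log (likelihoodRatio Q P (H i) 1 ω)| *
        G |Real.log (likelihoodRatio Q P (H i) 1 ω)|) P)
    (sel : Finset ι → ι) (hsel : ∀ s : Finset ι, s.Nonempty → sel s ∈ s) :
    (IsIIDLaw P →
      ∃ c : (ι → ℝ) → ι → ℝ, WaldAdmissible sel Q P H c ∧
        WaldAsymptoticallyOptimal G Q P H c P) ∧
    ((∃ w : ι → ℝ≥0∞, (∀ i, 0 < w i) ∧ P = ∑ i, w i • H i) →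
      ∃ c : (ι → ℝ) → ι → ℝ, WaldAdmissible sel Q P H c ∧
        ∀ i, WaldAsymptoticallyOptimal G Q P H c (H i)) := by
  have hadm : (∀ c : ι → ℝ, (∀ i, 0 < c i) → ∫⁻ ω, (waldTime Q P H c ω : ℝ≥0∞) ∂P < ⊤) →
      WaldAdmissible sel Q P H fun a i => (a i)⁻¹ := fun hfin a ha =>
    ⟨⟨isStoppingTime_waldTime Q P H _, hfin _ fun i => inv_pos.2 (ha i),
      measurableSet_waldDecision_eq sel⟩,
      errorsAtMost_waldTime hsel (fun i n => (hP i n).1)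
        (fun i => restr_absolutelyContinuous (hQ i)) ha⟩
  constructor
  · intro hPiid
    have href : IsReferenceLaw Q P P H 1 :=
      isReferenceLaw hG hdistinct hiid hQ hP hint hPiid (LocallyEquivalent.refl P) one_pos (by simp)
    have hA := hadm fun c hc => href.lintegral_waldTime_lt_top hc
    exact ⟨_, hA, href.waldAsymptoticallyOptimal hG hA⟩
  · rintro ⟨w, hw0, hPw⟩
    have hle : ∀ i, w i • H i ≤ P := by
      intro i A
      rw [hPw, Measure.coe_finsetSum, Finset.sum_apply]
      exact Finset.single_le_sum (f := fun i => (w i • H i) A) (fun _ _ => zero_le)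
        (Finset.mem_univ i)
    -- Each weight is at most the total mass of `P`, so it can serve as the real constant of a
    -- reference law.
    have hwtop : ∀ i, w i ≠ ⊤ := by
      intro i
      have h1 := hle i Set.univ
      rw [Measure.smul_apply, measure_univ, measure_univ, smul_eq_mul, mul_one] at h1
      exact (h1.trans_lt ENNReal.one_lt_top).ne
    have href : ∀ i, IsReferenceLaw Q P (H i) H (w i).toReal := fun i =>
      isReferenceLaw hG hdistinct hiid hQ hP hint (hiid i) (hP i)
        (ENNReal.toReal_pos (hw0 i).ne' (hwtop i)) (by
          rw [ENNReal.ofReal_toReal (hwtop i)]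
          exact hle i)
    have hsum : ∀ F : (ℕ → S) → ℝ≥0∞, ∫⁻ ω, F ω ∂P = ∑ i, w i * ∫⁻ ω, F ω ∂(H i) := fun F => by
      rw [hPw]
      simp
    have hA := hadm fun c hc => by
      rw [hsum]
      exact ENNReal.sum_lt_top.2 fun i _ =>
        ENNReal.mul_lt_top (hwtop i).lt_top ((href i).lintegral_waldTime_lt_top hc)
    exact ⟨_, hA, fun i => (href i).waldAsymptoticallyOptimal hG hA⟩
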